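/- Let $d\in\mathbb N$; write $z=(x,v)\in\mathbb R^{2d}$. For $k\ge 1$ let $\mathfrak g_k$ be the space of $f\in C^\infty((\mathbb R^{2d})^k;\mathbb R)$ invariant under permutations of $(z_1,\dots,z_k)$, with the topology of uniform convergence of all derivatives on compact sets, and let $\mathfrak g_k^*$ be its strong dual. Put $[f,g]_{\mathfrak g_k}=k\sum_{i=1}^k(\nabla_{x_i}f\cdot\nabla_{v_i}g-\nabla_{v_i}f\cdot\nabla_{x_i}g)$. Let $\mathfrak G_\infty=\bigoplus_{k\ge1}\mathfrak g_k$ and $\mathfrak G_\infty^*=\prod_{k\ge1}\mathfrak g_k^*$ (product topology), with pairing $\langle F,\Gamma\rangle=\sum_k\langle f^{(k)},\gamma^{(k)}\rangle$, and put $$[F,G]^{(k)}_{\mathfrak G_\infty}=\sum_{\ell+j-1=k}\mathrm{Sym}_k\big(f^{(\ell)}\wedge_1 g^{(j)}\big),\qquad \mathrm{Sym}_k(h)=\frac1{k!}\sum_{\pi\in S_k}h\circ\pi,$$ $$f^{(\ell)}\wedge_1 g^{(j)}(z_1,\dots,z_k)=\ell j\big(\nabla_{x_1}f^{(\ell)}(z_1,\dots,z_\ell)\cdot\nabla_{v_1}g^{(j)}(z_1,z_{\ell+1},\dots,z_k)-\nabla_{x_1}g^{(j)}(z_1,\dots,z_j)\cdot\nabla_{v_1}f^{(\ell)}(z_1,z_{j+1},\dots,z_k)\big).$$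 A map between topological vector spaces is $C^\infty$ if its iterated Gâteaux derivatives $\mathsf d^n f[x](v_1,\dots,v_n)$ exist and are jointly continuous for every $n\ge 0$. When $\mathsf d\mathcal F[\gamma]$ is given by pairing with an element of $\mathfrak g_k$ (resp. $\mathfrak G_\infty$) it is identified with that element, and the Lie–Poisson brackets are $$\{\mathcal F,\mathcal G\}_{\mathfrak g_k^*}(\gamma)=\langle[\mathsf d\mathcal F[\gamma],\mathsf d\mathcal G[\gamma]]_{\mathfrak g_k},\gamma\rangle,\qquad \{\mathcal F,\mathcal G\}_{\mathfrak G_\infty^*}(\Gamma)=\langle[\mathsf d\mathcal F[\Gamma],\mathsf d\mathcal G[\Gamma]]_{\mathfrak G_\infty},\Gamma\rangle .$$ Let $\mathcal A_\infty$ be the algebra of functionals on $\mathfrak G_\infty^*$ generated, under the pointwise product, by the constants and the functionals $\langle F,\cdot\rangle$, $F\in\mathfrak G_\infty$. For $W\in C^\infty(\mathbb R^d)$ even, set $\mathcal H_{Vl}(\gamma)=\langle\frac12|v|^2,\gamma\rangle+\langle W(x_1-x_2),\gamma^{\otimes2}\rangle$ on $\mathfrak g_1^*$ and $\mathcal H_{VlH}(\Gamma)=\langle(\frac12|v|^2,W(x_1-x_2),0,\dots),\Gamma\rangle$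 on $\mathfrak G_\infty^*$. Theorem. Let $\iota(\gamma)=(\gamma^{\otimes k})_{k\ge1}$ for $\gamma\in\mathfrak g_1^*$, where $\gamma^{\otimes k}$ is the $k$-fold tensor power of the distribution $\gamma$, that is, the functional that pairs with $\gamma$ successively in each of the $k$ variables; it is a well-defined element of $\mathfrak g_k^*$. Then $\iota:\mathfrak g_1^*\to\mathfrak G_\infty^*$ is $C^\infty$, and it is a Poisson morphism into $(\mathfrak G_\infty^*,\mathcal A_\infty,\{\cdot,\cdot\}_{\mathfrak G_\infty^*})$: for every $\mathcal F\in\mathcal A_\infty$ the functionals $\mathcal F$ and $\iota^*\mathcal F=\mathcal F\circ\iota$ are $C^\infty$, their Gâteaux derivatives at every point are given by unique elements of $\mathfrak G_\infty$ and $\mathfrak g_1$ respectively, and $$\{\iota^*\mathcal F,\iota^*\mathcal G\}_{\mathfrak g_1^*}=\iota^*\{\mathcal F,\mathcal G\}_{\mathfrak G_\infty^*}\qquad\text{for all }\mathcal F,\mathcal G\in\mathcal A_\infty .$$ Moreover $\iota^*\mathcal H_{VlH}=\mathcal H_{Vl}$ for every even $W\in C^\infty(\mathbb R^d)$. -/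

import Mathlib

open scoped ContDiff Topology

noncomputable section

namespace Vlasov

/-! ### Smooth maps between topological vector spaces -/

/-- The Gâteaux (directional) derivative of `f` at `x` in the direction `v` exists and equals `y`:
`y = lim_{h → 0} h⁻¹ (f (x + h v) - f x)`. -/
def HasGateauxDeriv {X Y : Type*} [AddCommGroup X] [Module ℝ X]
    [AddCommGroup Y] [Module ℝ Y] [TopologicalSpace Y] (f : X → Y) (x v : X) (y : Y) : Prop :=
  Filter.Tendsto (fun h : ℝ => h⁻¹ • (f (x + h • v) - f x)) (𝓝[≠] 0) (𝓝 y)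

/-- `f` is of class `C^∞` in the Gâteaux sense: all iterated directional derivatives
`D n x (v₁, …, vₙ) = dⁿf[x](v₁, …, vₙ)` exist, and each of them is (jointly) continuous on
`X × Xⁿ`. -/
def GateauxSmooth {X Y : Type*} [AddCommGroup X] [Module ℝ X] [TopologicalSpace X]
    [AddCommGroup Y] [Module ℝ Y] [TopologicalSpace Y] (f : X → Y) : Prop :=
  ∃ D : (n : ℕ) → X → (Fin n → X) → Y,
    (∀ x v, D 0 x v = f x) ∧
    (∀ (n : ℕ) (x : X) (v : Fin n → X) (w : X),
      HasGateauxDeriv (fun y => D n y v) x w (D (n + 1) x (Fin.snoc v w))) ∧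
    ∀ n : ℕ, Continuous fun p : X × (Fin n → X) => D n p.1 p.2

/-! ### Observables and states of `k` particles -/

/-- The one-particle phase space `ℝ^{2d}`, with points `z = (x, v)`. -/
abbrev Phase (d : ℕ) : Type := EuclideanSpace ℝ (Fin d) × EuclideanSpace ℝ (Fin d)

/-- Smooth real functions on `(ℝ^{2d})^k` that are invariant under permutations of the
particle labels, as a vector space. -/
def symmetricSmooth (d k : ℕ) : Submodule ℝ ((Fin k → Phase d) → ℝ) where
  carrier := {f | ContDiff ℝ ∞ f ∧ ∀ (π : Equiv.Perm (Fin k)) (z), f (z ∘ π) = f z}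
  add_mem' := fun hf hg =>
    ⟨hf.1.add hg.1, fun π z => by simp only [Pi.add_apply, hf.2 π z, hg.2 π z]⟩
  zero_mem' := ⟨contDiff_const, fun _ _ => rfl⟩
  smul_mem' := fun c _ hf =>
    ⟨contDiff_const.smul hf.1, fun π z => by simp only [Pi.smul_apply, hf.2 π z]⟩

/-- The space `𝔤_k` of `k`-particle observables. A type of its own, so that it does not inherit
the topology of pointwise convergence. -/
def Obs (d k : ℕ) : Type := symmetricSmooth d k

namespace Obs

variable {d k : ℕ}

instance : AddCommGroup (Obs d k) := inferInstanceAs (AddCommGroup (symmetricSmooth d k))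

instance : Module ℝ (Obs d k) := inferInstanceAs (Module ℝ (symmetricSmooth d k))

instance : CoeFun (Obs d k) (fun _ => (Fin k → Phase d) → ℝ) := ⟨fun f => f.1⟩

/-- The observable given by a smooth symmetric function. -/
def mk (f : (Fin k → Phase d) → ℝ) (hf : ContDiff ℝ ∞ f)
    (hs : ∀ (π : Equiv.Perm (Fin k)) (z), f (z ∘ π) = f z) : Obs d k := ⟨f, hf, hs⟩

theorem contDiff (f : Obs d k) : ContDiff ℝ ∞ f := f.2.1

theorem symm (f : Obs d k) (π : Equiv.Perm (Fin k)) (z : Fin k → Phase d) : f (z ∘ π) = f z :=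
  f.2.2 π z

theorem coe_add (f g : Obs d k) : ⇑(f + g) = (f : (Fin k → Phase d) → ℝ) + g := rfl

theorem coe_smul (c : ℝ) (f : Obs d k) : ⇑(c • f) = c • (f : (Fin k → Phase d) → ℝ) := rfl

theorem bddAbove_iteratedFDeriv (K : TopologicalSpace.Compacts (Fin k → Phase d)) (i : ℕ)
    (f : Obs d k) : BddAbove (Set.range fun z : K => ‖iteratedFDeriv ℝ i f z‖) := by
  have hc : Continuous fun z => ‖iteratedFDeriv ℝ i f z‖ :=
    (f.contDiff.continuous_iteratedFDeriv (by exact_mod_cast le_top)).norm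
  have := K.isCompact.bddAbove_image hc.continuousOn
  rwa [Set.image_eq_range] at this

/-- The seminorm `f ↦ sup_{z ∈ K} ‖D^i f(z)‖` on `𝔤_k`, for a compact `K` and an order `i`. -/
def seminorm (d k : ℕ) (p : TopologicalSpace.Compacts (Fin k → Phase d) × ℕ) :
    Seminorm ℝ (Obs d k) :=
  Seminorm.of (fun f => ⨆ z : p.1, ‖iteratedFDeriv ℝ p.2 f z‖)
    (fun f g => by
      rcases isEmpty_or_nonempty p.1 with hE | hE
      · simp [Real.iSup_of_isEmpty]
      · refine ciSup_le fun z => ?_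
        rw [coe_add, iteratedFDeriv_add_apply
          (f.contDiff.of_le (by exact_mod_cast le_top)).contDiffAt
          (g.contDiff.of_le (by exact_mod_cast le_top)).contDiffAt]
        exact (norm_add_le _ _).trans (add_le_add
          (le_ciSup (bddAbove_iteratedFDeriv p.1 p.2 f) z)
          (le_ciSup (bddAbove_iteratedFDeriv p.1 p.2 g) z)))
    (fun c f => by
      rw [Real.mul_iSup_of_nonneg (norm_nonneg c)]
      refine iSup_congr fun z => ?_
      rw [coe_smul, iteratedFDeriv_const_smul_apply
        (f.contDiff.of_le (by exact_mod_cast le_top)).contDiffAt, norm_smul])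

/-- The family of all the seminorms `sup_K ‖D^i f‖`. -/
def seminorms (d k : ℕ) :
    SeminormFamily ℝ (Obs d k) (TopologicalSpace.Compacts (Fin k → Phase d) × ℕ) :=
  seminorm d k

/-- The locally convex topology of `𝔤_k`: uniform convergence on compact sets of all
derivatives. -/
instance : TopologicalSpace (Obs d k) := (seminorms d k).moduleFilterBasis.topology

theorem withSeminorms (d k : ℕ) : WithSeminorms (seminorms d k) := ⟨rfl⟩

instance : IsTopologicalAddGroup (Obs d k) := (withSeminorms d k).topologicalAddGroup

instance : ContinuousSMul ℝ (Obs d k) := (withSeminorms d k).continuousSMul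

end Obs

/-- The space `𝔤_k^*` of `k`-particle states: the strong dual of `𝔤_k`, i.e. the continuous linear
functionals with the topology of uniform convergence on bounded sets. -/
abbrev State (d k : ℕ) : Type := Obs d k →L[ℝ] ℝ

/-! ### The Lie bracket of `𝔤_k` -/

/-- `∂f/∂x_i^m`: derivative in the `m`-th position coordinate of particle `i`. -/
def dx {d k : ℕ} (f : (Fin k → Phase d) → ℝ) (i : Fin k) (m : Fin d) (z : Fin k → Phase d) : ℝ :=
  fderiv ℝ f z (Pi.single i (EuclideanSpace.single m 1, 0))

/-- `∂f/∂v_i^m`: derivative in the `m`-th velocity coordinate of particle `i`. -/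
def dv {d k : ℕ} (f : (Fin k → Phase d) → ℝ) (i : Fin k) (m : Fin d) (z : Fin k → Phase d) : ℝ :=
  fderiv ℝ f z (Pi.single i (0, EuclideanSpace.single m 1))

/-- The standard Poisson bracket `∑_i (∇_{x_i} f · ∇_{v_i} g - ∇_{v_i} f · ∇_{x_i} g)`
on `(ℝ^{2d})^k`. -/
def poisson {d k : ℕ} (f g : (Fin k → Phase d) → ℝ) (z : Fin k → Phase d) : ℝ :=
  ∑ i, ∑ m, (dx f i m z * dv g i m z - dv f i m z * dx g i m z)

theorem contDiff_fderiv_apply {d k : ℕ} {f : (Fin k → Phase d) → ℝ} (hf : ContDiff ℝ ∞ f)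
    (u : Fin k → Phase d) : ContDiff ℝ ∞ fun z => fderiv ℝ f z u :=
  (hf.fderiv_right (m := ∞) (by simp)).clm_apply contDiff_const

theorem contDiff_dx {d k : ℕ} {f : (Fin k → Phase d) → ℝ} (hf : ContDiff ℝ ∞ f)
    (i : Fin k) (m : Fin d) : ContDiff ℝ ∞ (dx f i m) := contDiff_fderiv_apply hf _

theorem contDiff_dv {d k : ℕ} {f : (Fin k → Phase d) → ℝ} (hf : ContDiff ℝ ∞ f)
    (i : Fin k) (m : Fin d) : ContDiff ℝ ∞ (dv f i m) := contDiff_fderiv_apply hf _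

theorem contDiff_poisson {d k : ℕ} {f g : (Fin k → Phase d) → ℝ} (hf : ContDiff ℝ ∞ f)
    (hg : ContDiff ℝ ∞ g) : ContDiff ℝ ∞ (poisson f g) :=
  ContDiff.sum fun i _ => ContDiff.sum fun m _ =>
    ((contDiff_dx hf i m).mul (contDiff_dv hg i m)).sub
      ((contDiff_dv hf i m).mul (contDiff_dx hg i m))

theorem fderiv_comp_perm {d k : ℕ} (f : Obs d k) (π : Equiv.Perm (Fin k)) (z : Fin k → Phase d)
    (i : Fin k) (u : Phase d) :
    fderiv ℝ f (z ∘ π) (Pi.single i u) = fderiv ℝ f z (Pi.single (π i) u) := by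
  let L : (Fin k → Phase d) →L[ℝ] (Fin k → Phase d) :=
    ContinuousLinearMap.pi fun j => ContinuousLinearMap.proj (π j)
  have hL : ∀ w, L w = w ∘ π := fun w => rfl
  have hcomp : (f : (Fin k → Phase d) → ℝ) ∘ L = f := by
    funext w
    exact f.symm π w
  have hd : DifferentiableAt ℝ f (L z) :=
    (f.contDiff.differentiable (by simp)).differentiableAt
  have h2 : fderiv ℝ f z = (fderiv ℝ f (L z)).comp L := by
    conv_lhs => rw [← hcomp]
    rw [fderiv_comp z hd L.differentiableAt, L.fderiv]
  have h3 : L (Pi.single (π i) u) = Pi.single i u := by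
    rw [hL]
    funext j
    by_cases hj : j = i
    · subst hj; simp
    · simp [hj]
  rw [h2, ContinuousLinearMap.comp_apply, h3, hL]

theorem poisson_symm {d k : ℕ} (f g : Obs d k) (π : Equiv.Perm (Fin k)) (z : Fin k → Phase d) :
    poisson f g (z ∘ π) = poisson f g z := by
  unfold poisson dx dv
  simp only [fderiv_comp_perm]
  exact Equiv.sum_comp π fun i => ∑ m : Fin d,
    (fderiv ℝ f z (Pi.single i (EuclideanSpace.single m 1, 0)) *
        fderiv ℝ g z (Pi.single i (0, EuclideanSpace.single m 1)) -
      fderiv ℝ f z (Pi.single i (0, EuclideanSpace.single m 1)) *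
        fderiv ℝ g z (Pi.single i (EuclideanSpace.single m 1, 0)))

/-- The Lie bracket `[f, g]_{𝔤_k} = k {f, g}_{(ℝ^{2d})^k}`. -/
def lieObs {d k : ℕ} (f g : Obs d k) : Obs d k :=
  Obs.mk (fun z => k * poisson f g z)
    (contDiff_const.mul (contDiff_poisson f.contDiff g.contDiff))
    (fun π z => by rw [poisson_symm])

/-! ### The Lie–Poisson bracket of `𝔤_k^*` -/

/-- `f ∈ 𝔤_k` represents the Gâteaux derivative `d𝓕[γ]`, i.e. `d𝓕[γ](ν) = ⟨f, ν⟩` for all `ν`. -/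
def IsGradient {d k : ℕ} (𝓕 : State d k → ℝ) (γ : State d k) (f : Obs d k) : Prop :=
  ∀ ν : State d k, HasGateauxDeriv 𝓕 γ ν (ν f)

open Classical in
/-- `d𝓕[γ]` as an element of `𝔤_k` (and `0` if it is not represented by such an element). -/
def gradient {d k : ℕ} (𝓕 : State d k → ℝ) (γ : State d k) : Obs d k :=
  if h : ∃ f, IsGradient 𝓕 γ f then h.choose else 0

/-- `{𝓕, 𝓖}_{𝔤_k^*}(γ) = ⟨[d𝓕[γ], d𝓖[γ]]_{𝔤_k}, γ⟩`. -/
def liePoisson {d k : ℕ} (𝓕 𝓖 : State d k → ℝ) (γ : State d k) : ℝ :=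
  γ (lieObs (gradient 𝓕 γ) (gradient 𝓖 γ))

/-! ### Hierarchies of observables and of states

Hierarchies are indexed by `n : ℕ`; the entry with index `n` is the one for `k = n + 1` particles,
so that `k` runs over `1, 2, 3, …`. -/

/-- The space `𝔊_∞ = ⨁_{k ≥ 1} 𝔤_k` of observable hierarchies. -/
abbrev ObsHierarchy (d : ℕ) : Type := DirectSum ℕ fun n => Obs d (n + 1)

/-- The space `𝔊_∞^* = ∏_{k ≥ 1} 𝔤_k^*` of state hierarchies, with the product topology. -/
abbrev StateHierarchy (d : ℕ) : Type := (n : ℕ) → State d (n + 1)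

/-- The duality pairing `⟨F, Γ⟩ = ∑_{k ≥ 1} ⟨f^{(k)}, γ^{(k)}⟩` (a finite sum). -/
def pairing {d : ℕ} (F : ObsHierarchy d) (Γ : StateHierarchy d) : ℝ :=
  DirectSum.toModule ℝ ℕ ℝ (fun n => (Γ n : Obs d (n + 1) →ₗ[ℝ] ℝ)) F

/-! ### The Lie bracket of `𝔊_∞` -/

/-- The first `a + 1` of `n + 1` particles. -/
def headTuple {d n : ℕ} (a : ℕ) (ha : a ≤ n) (z : Fin (n + 1) → Phase d) : Fin (a + 1) → Phase d :=
  fun i => z (Fin.castLE (Nat.add_le_add_right ha 1) i)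

/-- The first particle, followed by the last `b` of `a + b + 1 = n + 1` particles. With `ℓ = a + 1`,
`k = n + 1` and particles numbered from `1`, this is `(z_1, z_{ℓ+1}, …, z_k)`. -/
def skipTuple {d n : ℕ} (a b : ℕ) (h : a + b = n) (z : Fin (n + 1) → Phase d) :
    Fin (b + 1) → Phase d :=
  Fin.cons (z 0) fun i : Fin b => z ⟨a + 1 + i, by omega⟩

/-- For `f ∈ 𝔤_ℓ`, `g ∈ 𝔤_j` (`ℓ = a + 1`, `j = b + 1`, `k = n + 1 = ℓ + j - 1`), the function
`∇_{x_1} f(z_1, …, z_ℓ) · ∇_{v_1} g(z_1, z_{ℓ+1}, …, z_k)` on `(ℝ^{2d})^k`. -/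
def contract {d n : ℕ} (a b : ℕ) (h : a + b = n) (f : Obs d (a + 1)) (g : Obs d (b + 1))
    (z : Fin (n + 1) → Phase d) : ℝ :=
  ∑ m : Fin d, dx f 0 m (headTuple a (by omega) z) * dv g 0 m (skipTuple a b h z)

/-- `(f ∧₁ g)(z_1, …, z_k) = ℓ j (∇_{x_1} f(z_1, …, z_ℓ) · ∇_{v_1} g(z_1, z_{ℓ+1}, …, z_k)
- ∇_{x_1} g(z_1, …, z_j) · ∇_{v_1} f(z_1, z_{j+1}, …, z_k))`. -/
def wedge {d : ℕ} (a b : ℕ) (f : Obs d (a + 1)) (g : Obs d (b + 1))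
    (z : Fin (a + b + 1) → Phase d) : ℝ :=
  ((a + 1 : ℕ) : ℝ) * ((b + 1 : ℕ) : ℝ) *
    (contract a b rfl f g z - contract b a (Nat.add_comm b a) g f z)

theorem contDiff_headTuple {d n : ℕ} (a : ℕ) (ha : a ≤ n) :
    ContDiff ℝ ∞ (headTuple a ha : (Fin (n + 1) → Phase d) → Fin (a + 1) → Phase d) :=
  contDiff_pi.2 fun _ => contDiff_apply _ _ _

theorem contDiff_skipTuple {d n : ℕ} (a b : ℕ) (h : a + b = n) :
    ContDiff ℝ ∞ (skipTuple a b h : (Fin (n + 1) → Phase d) → Fin (b + 1) → Phase d) := by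
  refine contDiff_pi.2 fun i => ?_
  refine Fin.cases ?_ (fun i => ?_) i
  · exact contDiff_apply _ _ _
  · exact contDiff_apply _ _ _

theorem contDiff_contract {d n : ℕ} (a b : ℕ) (h : a + b = n) (f : Obs d (a + 1))
    (g : Obs d (b + 1)) : ContDiff ℝ ∞ (contract a b h f g) :=
  ContDiff.sum fun m _ =>
    ((contDiff_dx f.contDiff 0 m).comp (contDiff_headTuple a _)).mul
      ((contDiff_dv g.contDiff 0 m).comp (contDiff_skipTuple a b h))

theorem contDiff_wedge {d : ℕ} (a b : ℕ) (f : Obs d (a + 1)) (g : Obs d (b + 1)) :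
    ContDiff ℝ ∞ (wedge a b f g) :=
  contDiff_const.mul ((contDiff_contract a b _ f g).sub (contDiff_contract b a _ g f))

/-- Symmetrization: `Sym_k(h) = (1 / k!) ∑_{π ∈ S_k} h ∘ π`. -/
def sym {d k : ℕ} (h : (Fin k → Phase d) → ℝ) (hh : ContDiff ℝ ∞ h) : Obs d k :=
  Obs.mk (fun z => ((k.factorial : ℝ))⁻¹ * ∑ π : Equiv.Perm (Fin k), h (z ∘ π))
    (contDiff_const.mul (ContDiff.sum fun π _ =>
      hh.comp (contDiff_pi.2 fun i => contDiff_apply ℝ (Phase d) (π i))))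
    (fun σ z => by
      congr 1
      exact Equiv.sum_comp (Equiv.mulLeft σ) fun π : Equiv.Perm (Fin k) => h (z ∘ π))

open Classical in
/-- The Lie bracket of `𝔊_∞`: `[F, G]^{(k)} = ∑_{ℓ + j - 1 = k} Sym_k(f^{(ℓ)} ∧₁ g^{(j)})`. -/
def lieHierarchy {d : ℕ} (F G : ObsHierarchy d) : ObsHierarchy d :=
  ∑ a ∈ DFinsupp.support F, ∑ b ∈ DFinsupp.support G,
    DirectSum.of (fun n => Obs d (n + 1)) (a + b)
      (sym (wedge a b (F a) (G b)) (contDiff_wedge a b (F a) (G b)))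

/-! ### The Lie–Poisson bracket of `𝔊_∞^*` and the algebra `𝒜_∞` -/

/-- `F ∈ 𝔊_∞` represents the Gâteaux derivative `d𝓕[Γ]`, i.e. `d𝓕[Γ](Δ) = ⟨F, Δ⟩` for
all `Δ`. -/
def IsHierarchyGradient {d : ℕ} (𝓕 : StateHierarchy d → ℝ) (Γ : StateHierarchy d)
    (F : ObsHierarchy d) : Prop :=
  ∀ Δ : StateHierarchy d, HasGateauxDeriv 𝓕 Γ Δ (pairing F Δ)

open Classical in
/-- `d𝓕[Γ]` as an element of `𝔊_∞` (and `0` if it is not represented by such an element). -/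
def hierarchyGradient {d : ℕ} (𝓕 : StateHierarchy d → ℝ) (Γ : StateHierarchy d) :
    ObsHierarchy d :=
  if h : ∃ F, IsHierarchyGradient 𝓕 Γ F then h.choose else 0

/-- `{𝓕, 𝓖}_{𝔊_∞^*}(Γ) = ⟨[d𝓕[Γ], d𝓖[Γ]]_{𝔊_∞}, Γ⟩`. -/
def liePoissonHierarchy {d : ℕ} (𝓕 𝓖 : StateHierarchy d → ℝ) (Γ : StateHierarchy d) : ℝ :=
  pairing (lieHierarchy (hierarchyGradient 𝓕 Γ) (hierarchyGradient 𝓖 Γ)) Γ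

/-- The algebra `𝒜_∞` generated, under the pointwise product, by the expectations `⟨F, ·⟩`,
`F ∈ 𝔊_∞`, and the constants (a subalgebra contains the constants). -/
def admissible (d : ℕ) : Subalgebra ℝ (StateHierarchy d → ℝ) :=
  Algebra.adjoin ℝ (Set.range fun F : ObsHierarchy d => pairing F)

/-! ### Tensor powers and the factorization map -/

open Classical in
/-- The value `⟨φ, γ⟩` of a one-particle state on a smooth function `φ` of `z ∈ ℝ^{2d}`
(and `0` if `φ` is not smooth). -/
def pairOne {d : ℕ} (γ : State d 1) (φ : Phase d → ℝ) : ℝ :=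
  if h : ContDiff ℝ ∞ φ then
    γ (Obs.mk (fun z => φ (z 0)) (h.comp (contDiff_apply ℝ (Phase d) 0))
      (fun π z => by rw [Function.comp_apply, Subsingleton.elim (π 0) 0]))
  else 0

/-- The iterated pairing `⟨⋯⟨⟨f(z_1, …, z_k), γ(z_k)⟩, γ(z_{k-1})⟩ ⋯, γ(z_1)⟩`. -/
def iteratedPairing {d : ℕ} (γ : State d 1) : (k : ℕ) → ((Fin k → Phase d) → ℝ) → ℝ
  | 0, f => f Fin.elim0
  | k + 1, f => pairOne γ fun z => iteratedPairing γ k fun w => f (Fin.cons z w)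

open Classical in
/-- The tensor power `γ^{⊗k} ∈ 𝔤_k^*`: the continuous functional whose value on `f` is the
iterated pairing of `f` with `γ` (and `0` if the iterated pairing is not such a functional). -/
def tensorPower {d : ℕ} (γ : State d 1) (k : ℕ) : State d k :=
  if h : ∃ T : State d k, ∀ f : Obs d k, T f = iteratedPairing γ k f then h.choose else 0

/-- The factorization map `ι : 𝔤_1^* → 𝔊_∞^*`, `ι(γ) = (γ^{⊗k})_{k ≥ 1}`. -/
def factorization (d : ℕ) (γ : State d 1) : StateHierarchy d := fun n => tensorPower γ (n + 1)

/-! ### The Hamiltonians -/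

/-- The one-particle observable `½ |v|²`. -/
def kinetic (d : ℕ) : Obs d 1 :=
  Obs.mk (fun z => (1 / 2 : ℝ) * ‖(z 0).2‖ ^ 2)
    (contDiff_const.mul
      ((contDiff_snd.comp (contDiff_apply ℝ (Phase d) (0 : Fin 1))).norm_sq ℝ))
    (fun π z => by rw [Function.comp_apply, Subsingleton.elim (π 0) 0])

/-- The two-particle observable `W(x_1 - x_2)`, for a smooth even potential `W`. -/
def interaction {d : ℕ} (W : EuclideanSpace ℝ (Fin d) → ℝ) (hW : ContDiff ℝ ∞ W)
    (hev : ∀ x, W (-x) = W x) : Obs d 2 :=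
  Obs.mk (fun z => W ((z 0).1 - (z 1).1))
    (hW.comp ((contDiff_fst.comp (contDiff_apply ℝ (Phase d) (0 : Fin 2))).sub
      (contDiff_fst.comp (contDiff_apply ℝ (Phase d) (1 : Fin 2)))))
    (fun π z => by
      have h : (π 0 = 0 ∧ π 1 = 1) ∨ (π 0 = 1 ∧ π 1 = 0) := by
        revert π; decide
      rcases h with ⟨h0, h1⟩ | ⟨h0, h1⟩
      · simp only [Function.comp_apply, h0, h1]
      · simp only [Function.comp_apply, h0, h1]
        rw [← hev, neg_sub])

/-- The Vlasov Hamiltonian `𝓗_Vl(γ) = ⟨½ |v|², γ⟩ + ⟨W(x_1 - x_2), γ^{⊗2}⟩`. -/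
def vlasovHamiltonian {d : ℕ} (W : EuclideanSpace ℝ (Fin d) → ℝ) (hW : ContDiff ℝ ∞ W)
    (hev : ∀ x, W (-x) = W x) (γ : State d 1) : ℝ :=
  γ (kinetic d) + tensorPower γ 2 (interaction W hW hev)

/-- The Vlasov hierarchy Hamiltonian `𝓗_VlH(Γ) = ⟨(½ |v|², W(x_1 - x_2), 0, …), Γ⟩`. -/
def vlasovHierarchyHamiltonian {d : ℕ} (W : EuclideanSpace ℝ (Fin d) → ℝ) (hW : ContDiff ℝ ∞ W)
    (hev : ∀ x, W (-x) = W x) (Γ : StateHierarchy d) : ℝ :=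
  pairing (DirectSum.of (fun n => Obs d (n + 1)) 0 (kinetic d) +
    DirectSum.of (fun n => Obs d (n + 1)) 1 (interaction W hW hev)) Γ

end Vlasov

end

/-!
The tensor power `γ ↦ γ^{⊗k}` is obtained by iterating a bilinear tensor product
`𝔤_1^* × 𝔤_k^* → 𝔤_{k+1}^*`, `(γ ⊗ ν)(f) = ⟨z ↦ ⟨f (z, ·), ν⟩, γ⟩`. Three facts about it carry the
proof.

* It is well defined: a state may be differentiated under the pairing, so that
  `z ↦ ⟨f (z, ·), ν⟩` is smooth and depends continuously on `f` (`contDiff_family`,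
  `continuous_partialPairing`). This rests on the uniformity on compact sets of the Taylor
  remainder of a smooth function (`tendsto_slice_remainder`).
* It is jointly continuous for the strong topologies (`continuous_tensorBilin`). As `f` runs over a
  bounded set of observables, the derivatives in `z` of `f (z, ·)` of order at most `n` at the
  points of the ball of radius `n` form a sequence of bounded sets. By Mackey's countability
  argument, some rescaling of this sequence has bounded union `B`, and when `|ν| ≤ 1` on `B` the
  partial pairings `z ↦ ⟨f (z, ·), ν⟩` stay in a bounded set.
* Its first two factors may be exchanged on symmetric functions (`tensor_left_comm`), by Fubini's
  theorem for states (`apply_familyObs_comm`): the Hahn–Banach theorem writes a state as a finite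
  sum of functionals on spaces `C(K)` applied to derivatives, and on `C(K × L)` Fubini's theorem
  follows from the density of sums of products.

Gâteaux smooth maps are stable under continuous bilinear operations (`GateauxContDiff.bilin`), hence
`ι`, the admissible functionals and their pullbacks are smooth. By symmetry the derivative of
`γ ↦ γ^{⊗k}` in the direction `ν` is `k ν ⊗ γ^{⊗(k-1)}`, so the gradient at `γ` of the pullback of
`𝓕` is the image of the gradient `F = (f^{(k)})` of `𝓕` at `ι(γ)` under the linear map
`F ↦ ∑_k k ⟨f^{(k)} (z, ·), γ^{⊗(k-1)}⟩` (`pullbackGradient`); gradients are unique since evaluations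
at points are states. It remains to compare the two Lie brackets when paired with `γ` and `ι(γ)`
(`apply_lieObs_pullbackGradient`): iterated pairings with `γ` are invariant under permutations of
the particles, which removes the symmetrization, and are multiplicative on functions of disjoint
groups of particles, which after freezing the common particle `z_1` turns `f ∧₁ g` into the Poisson
bracket of the partial pairings.
-/

namespace Vlasov

/-! ### Iterated directional derivatives -/

section DirDeriv

variable {W : Type*} [NormedAddCommGroup W] [NormedSpace ℝ W]

/-- The iterated directional derivative `∂_{m 0} ⋯ ∂_{m (i - 1)} f`. -/
noncomputable def dirDeriv {i : ℕ} (m : Fin i → W) (f : W → ℝ) : W → ℝ :=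
  fun z => iteratedFDeriv ℝ i f z m

theorem contDiff_fderiv_const {f : W → ℝ} (hf : ContDiff ℝ ∞ f) (w : W) :
    ContDiff ℝ ∞ fun z => fderiv ℝ f z w :=
  (hf.fderiv_right (m := ∞) (by simp)).clm_apply contDiff_const

theorem contDiff_iteratedFDeriv {f : W → ℝ} (hf : ContDiff ℝ ∞ f) (i : ℕ) :
    ContDiff ℝ ∞ (iteratedFDeriv ℝ i f) :=
  hf.iteratedFDeriv_right (m := ∞) (by exact_mod_cast le_top)

theorem contDiff_dirDeriv {f : W → ℝ} (hf : ContDiff ℝ ∞ f) {i : ℕ} (m : Fin i → W) :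
    ContDiff ℝ ∞ (dirDeriv m f) :=
  (ContinuousMultilinearMap.apply ℝ (fun _ : Fin i => W) ℝ m).contDiff.comp
    (contDiff_iteratedFDeriv hf i)

theorem dirDeriv_zero (m : Fin 0 → W) (f : W → ℝ) : dirDeriv m f = f := by
  funext z
  simp [dirDeriv]

theorem fderiv_dirDeriv {f : W → ℝ} (hf : ContDiff ℝ ∞ f) {i : ℕ} (m : Fin i → W) (z w : W) :
    fderiv ℝ (dirDeriv m f) z w = fderiv ℝ (iteratedFDeriv ℝ i f) z w m := by
  have h := (ContinuousMultilinearMap.apply ℝ (fun _ : Fin i => W) ℝ m).hasFDerivAt.comp z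
    (((contDiff_iteratedFDeriv hf i).differentiable (by simp)) z).hasFDerivAt
  have h' : HasFDerivAt (dirDeriv m f) _ z := h
  rw [h'.fderiv]
  rfl

theorem dirDeriv_succ {f : W → ℝ} (hf : ContDiff ℝ ∞ f) {i : ℕ} (m : Fin (i + 1) → W) :
    dirDeriv m f = fun z => fderiv ℝ (dirDeriv (Fin.tail m) f) z (m 0) := by
  funext z
  rw [fderiv_dirDeriv hf]
  rfl

theorem fderiv_fderiv_comm {f : W → ℝ} (hf : ContDiff ℝ ∞ f) (u w z : W) :
    fderiv ℝ (fun y => fderiv ℝ f y u) z w = fderiv ℝ (fun y => fderiv ℝ f y w) z u := by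
  have hd : DifferentiableAt ℝ (fderiv ℝ f) z :=
    ((hf.fderiv_right (m := ∞) (by simp)).differentiable (by simp)) z
  have hs : IsSymmSndFDerivAt ℝ f z :=
    hf.contDiffAt.isSymmSndFDerivAt (by
      simpa using (WithTop.coe_le_coe.2 le_top : ((2 : ℕ∞) : WithTop ℕ∞) ≤ ∞))
  rw [fderiv_clm_apply hd (differentiableAt_const _), fderiv_clm_apply hd
    (differentiableAt_const _)]
  simpa using hs w u

theorem dirDeriv_fderiv {i : ℕ} {f : W → ℝ} (hf : ContDiff ℝ ∞ f) (m : Fin i → W) (w : W) :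
    dirDeriv m (fun z => fderiv ℝ f z w) = fun z => fderiv ℝ (dirDeriv m f) z w := by
  induction i with
  | zero => simp only [dirDeriv_zero]
  | succ i ih =>
    rw [dirDeriv_succ (contDiff_fderiv_const hf w), ih, dirDeriv_succ hf]
    funext z
    exact fderiv_fderiv_comm (contDiff_dirDeriv hf _) _ _ _

theorem iteratedFDeriv_fderiv_apply {f : W → ℝ} (hf : ContDiff ℝ ∞ f) (i : ℕ) (w z : W) :
    iteratedFDeriv ℝ i (fun y => fderiv ℝ f y w) z = fderiv ℝ (iteratedFDeriv ℝ i f) z w := by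
  ext m
  rw [← fderiv_dirDeriv hf]
  exact congrFun (dirDeriv_fderiv hf m w) z

theorem dirDeriv_comm {i j : ℕ} {f : W → ℝ} (hf : ContDiff ℝ ∞ f) (m : Fin i → W)
    (n : Fin j → W) : dirDeriv n (dirDeriv m f) = dirDeriv m (dirDeriv n f) := by
  induction i with
  | zero => simp only [dirDeriv_zero]
  | succ i ih =>
    rw [dirDeriv_succ hf, dirDeriv_fderiv (contDiff_dirDeriv hf _), ih,
      dirDeriv_succ (contDiff_dirDeriv hf n)]

theorem dirDeriv_dirDeriv_apply {i j : ℕ} {f : W → ℝ} (hf : ContDiff ℝ ∞ f) (m : Fin i → W)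
    (n : Fin j → W) (z : W) :
    dirDeriv n (dirDeriv m f) z = iteratedFDeriv ℝ j (iteratedFDeriv ℝ i f) z n m := by
  have h := (ContinuousMultilinearMap.apply ℝ (fun _ : Fin i => W) ℝ m).iteratedFDeriv_comp_left
    (contDiff_iteratedFDeriv hf i).contDiffAt (x := z) (i := j) (by exact_mod_cast le_top)
  exact congrArg (fun T => T n) h

/-- Derivatives of order `j` of a derivative along `i` vectors of the unit ball are bounded by the
derivative of order `i + j`. -/
theorem norm_iteratedFDeriv_dirDeriv_le {i : ℕ} {f : W → ℝ} (hf : ContDiff ℝ ∞ f)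
    (m : Fin i → W) (hm : ∀ l, ‖m l‖ ≤ 1) (j : ℕ) (z : W) :
    ‖iteratedFDeriv ℝ j (dirDeriv m f) z‖ ≤ ‖iteratedFDeriv ℝ (i + j) f z‖ := by
  induction i generalizing j with
  | zero => rw [dirDeriv_zero, zero_add]
  | succ i ih =>
    have h2 : ‖iteratedFDeriv ℝ (j + 1) (dirDeriv (Fin.tail m) f) z‖
        ≤ ‖iteratedFDeriv ℝ (i + 1 + j) f z‖ := by
      rw [add_assoc, add_comm 1 j]
      exact ih (Fin.tail m) (fun l => hm _) (j + 1)
    refine le_trans ?_ h2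
    rw [dirDeriv_succ hf, iteratedFDeriv_fderiv_apply (contDiff_dirDeriv hf _),
      ← norm_fderiv_iteratedFDeriv]
    refine (ContinuousLinearMap.le_opNorm _ _).trans ?_
    exact mul_le_of_le_one_right (norm_nonneg _) (hm 0)

end DirDeriv

/-! ### Families of observables depending on a parameter -/

section Slice

variable {d k : ℕ} {P W : Type*} [NormedAddCommGroup P] [NormedSpace ℝ P]
  [NormedAddCommGroup W] [NormedSpace ℝ W]
  {a : P →L[ℝ] W} {b : (Fin k → Phase d) →L[ℝ] W} {f g : W → ℝ}

/-- A smooth `f` on `W` which, as a function `w ↦ f (a x + b w)` of the `k` particles `w`, is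
symmetric for every value of the parameter `x`. -/
structure IsSymFamily (a : P →L[ℝ] W) (b : (Fin k → Phase d) →L[ℝ] W) (f : W → ℝ) : Prop where
  smooth : ContDiff ℝ ∞ f
  symm : ∀ (x : P) (π : Equiv.Perm (Fin k)) (w : Fin k → Phase d),
    f (a x + b (w ∘ π)) = f (a x + b w)

/-- The observable `w ↦ f (a x + b w)`. -/
noncomputable def slice (hf : IsSymFamily a b f) (x : P) : Obs d k :=
  Obs.mk (fun w => f (a x + b w)) (hf.smooth.comp (contDiff_const.add b.contDiff)) (hf.symm x)

theorem slice_apply (hf : IsSymFamily a b f) (x : P) (w : Fin k → Phase d) :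
    slice hf x w = f (a x + b w) := rfl

theorem Obs.ext {φ ψ : Obs d k} (h : ∀ z, φ z = ψ z) : φ = ψ :=
  Subtype.ext (funext h)

theorem fderiv_family (hf : ContDiff ℝ ∞ f) (x u : P) (w : Fin k → Phase d) :
    fderiv ℝ (fun y => f (a y + b w)) x u = fderiv ℝ f (a x + b w) (a u) := by
  have h1 : HasFDerivAt (fun y => a y + b w) a x := a.hasFDerivAt.add_const _
  have h2 := ((hf.differentiable (by simp)) (a x + b w)).hasFDerivAt.comp x h1
  have h3 : HasFDerivAt (fun y => f (a y + b w)) _ x := h2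
  rw [h3.fderiv]
  rfl

theorem IsSymFamily.fderiv (hf : IsSymFamily a b f) (u : P) :
    IsSymFamily a b fun z => fderiv ℝ f z (a u) where
  smooth := contDiff_fderiv_const hf.smooth _
  symm x π w := by
    rw [← fderiv_family hf.smooth, ← fderiv_family hf.smooth]
    simp only [hf.symm]

theorem IsSymFamily.dirDeriv (hf : IsSymFamily a b f) {i : ℕ} (h : Fin i → P) :
    IsSymFamily a b (dirDeriv (fun l => a (h l)) f) := by
  induction i with
  | zero => rwa [dirDeriv_zero]
  | succ i ih =>
    rw [dirDeriv_succ hf.smooth]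
    exact (ih (Fin.tail h)).fderiv (h 0)

theorem IsSymFamily.sub (hf : IsSymFamily a b f) (hg : IsSymFamily a b g) :
    IsSymFamily a b (fun z => f z - g z) where
  smooth := hf.smooth.sub hg.smooth
  symm x π w := by rw [hf.symm, hg.symm]

theorem IsSymFamily.translate (hf : IsSymFamily a b f) (u : P) :
    IsSymFamily a b (fun z => f (a u + z)) where
  smooth := hf.smooth.comp (contDiff_const.add contDiff_id)
  symm x π w := by rw [← add_assoc, ← add_assoc, ← map_add, hf.symm]

theorem Obs.norm_iteratedFDeriv_le_seminorms (p : TopologicalSpace.Compacts (Fin k → Phase d) × ℕ)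
    (φ : Obs d k) {z : Fin k → Phase d} (hz : z ∈ p.1) :
    ‖iteratedFDeriv ℝ p.2 φ z‖ ≤ Obs.seminorms d k p φ :=
  le_ciSup (Obs.bddAbove_iteratedFDeriv p.1 p.2 φ) ⟨z, hz⟩

theorem Obs.seminorms_le (p : TopologicalSpace.Compacts (Fin k → Phase d) × ℕ)
    (φ : Obs d k) {C : ℝ} (hC : 0 ≤ C) (h : ∀ z ∈ p.1, ‖iteratedFDeriv ℝ p.2 φ z‖ ≤ C) :
    Obs.seminorms d k p φ ≤ C :=
  Real.iSup_le (fun z => h z z.2) hC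

theorem iteratedFDeriv_slice (hf : IsSymFamily a b f) (x : P) (i : ℕ) (w : Fin k → Phase d) :
    iteratedFDeriv ℝ i (slice hf x) w =
      (iteratedFDeriv ℝ i f (a x + b w)).compContinuousLinearMap fun _ => b := by
  have h1 : ContDiff ℝ ∞ fun z => f (a x + z) := hf.smooth.comp (contDiff_const.add contDiff_id)
  have h := b.iteratedFDeriv_comp_right h1 w (i := i) (by exact_mod_cast le_top)
  rw [iteratedFDeriv_comp_add_left] at h
  exact h

theorem norm_iteratedFDeriv_slice_le (hf : IsSymFamily a b f) (x : P) (i : ℕ)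
    (w : Fin k → Phase d) :
    ‖iteratedFDeriv ℝ i (slice hf x) w‖ ≤ ‖b‖ ^ i * ‖iteratedFDeriv ℝ i f (a x + b w)‖ := by
  rw [iteratedFDeriv_slice, mul_comm]
  refine (ContinuousMultilinearMap.norm_compContinuousLinearMap_le _ _).trans ?_
  simp

theorem seminorms_slice_le (hf : IsSymFamily a b f) (x : P)
    (p : TopologicalSpace.Compacts (Fin k → Phase d) × ℕ) {C : ℝ} (hC : 0 ≤ C)
    (h : ∀ w ∈ p.1, ‖iteratedFDeriv ℝ p.2 f (a x + b w)‖ ≤ C) :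
    Obs.seminorms d k p (slice hf x) ≤ ‖b‖ ^ p.2 * C :=
  Obs.seminorms_le p _ (by positivity) fun w hw =>
    (norm_iteratedFDeriv_slice_le hf x p.2 w).trans
      (mul_le_mul_of_nonneg_left (h w hw) (by positivity))

/-- The first order Taylor remainder of a `C^1` map is small uniformly on compact sets. -/
theorem eventually_taylor_remainder_le {E V : Type*} [NormedAddCommGroup E] [NormedSpace ℝ E]
    [TopologicalSpace V] {G : W → E} (hG : ContDiff ℝ 1 G) {c : V → W} (hc : Continuous c)
    {K : Set V} (hK : IsCompact K) {δ : ℝ} (hδ : 0 < δ) :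
    ∀ᶠ u in 𝓝 (0 : W), ∀ w ∈ K, ‖G (u + c w) - G (c w) - fderiv ℝ G (c w) u‖ ≤ δ * ‖u‖ := by
  have hG' : Continuous (fderiv ℝ G) := hG.continuous_fderiv (by simp)
  have hev : ∀ᶠ u in 𝓝 (0 : W), ∀ w ∈ K,
      ‖fderiv ℝ G (u + c w) - fderiv ℝ G (c w)‖ < δ := by
    refine hK.eventually_forall_of_forall_eventually fun w _ => ?_
    have hcont : Continuous fun q : W × V =>
        ‖fderiv ℝ G (q.1 + c q.2) - fderiv ℝ G (c q.2)‖ := by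
      fun_prop
    refine hcont.continuousAt.eventually_lt continuousAt_const ?_
    simpa using hδ
  obtain ⟨r, hr, hball⟩ := Metric.eventually_nhds_iff_ball.1 hev
  filter_upwards [Metric.ball_mem_nhds (0 : W) hr] with u hu w hw
  have hmv := (convex_segment (𝕜 := ℝ) (c w) (u + c w)).norm_image_sub_le_of_norm_fderiv_le'
    (f := G) (φ := fderiv ℝ G (c w)) (C := δ) (fun z _ => (hG.differentiable (by simp)) z) ?_
    (left_mem_segment ℝ _ _) (right_mem_segment ℝ _ _)
  · simpa using hmv
  · intro z hz
    rw [segment_eq_image'] at hz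
    obtain ⟨t, ⟨ht0, ht1⟩, rfl⟩ := hz
    have hmem : t • u ∈ Metric.ball (0 : W) r := by
      rw [mem_ball_zero_iff] at hu ⊢
      rw [norm_smul, Real.norm_of_nonneg ht0]
      exact lt_of_le_of_lt (mul_le_of_le_one_left (norm_nonneg _) ht1) hu
    simpa [add_comm] using (hball _ hmem w hw).le

/-- Compactness makes the remainder of the first order Taylor expansion of `w ↦ f (a x + b w)` in
the parameter `x` small uniformly on compact sets, together with all derivatives in `w`. -/
theorem tendsto_slice_remainder (hf : IsSymFamily a b f) (x : P) :
    Filter.Tendsto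
      (fun u => ‖u‖⁻¹ • (slice hf (x + u) - slice hf x - slice (hf.fderiv u) x)) (𝓝 0) (𝓝 0) := by
  rw [(Obs.withSeminorms d k).tendsto_nhds]
  intro p ε hε
  set G := iteratedFDeriv ℝ p.2 f with hG
  have hGs : ContDiff ℝ ∞ G := contDiff_iteratedFDeriv hf.smooth _
  obtain ⟨δ, hδ, hδε⟩ : ∃ δ : ℝ, 0 < δ ∧ ‖b‖ ^ p.2 * (δ * ‖a‖) < ε := by
    refine ⟨ε / (2 * (‖b‖ ^ p.2 * ‖a‖ + 1)), by positivity, ?_⟩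
    have : ‖b‖ ^ p.2 * (ε / (2 * (‖b‖ ^ p.2 * ‖a‖ + 1)) * ‖a‖)
      = ε * ((‖b‖ ^ p.2 * ‖a‖) / (2 * (‖b‖ ^ p.2 * ‖a‖ + 1))) := by ring
    rw [this]
    refine mul_lt_of_lt_one_right hε ?_
    rw [div_lt_one (by positivity)]
    have : 0 ≤ ‖b‖ ^ p.2 * ‖a‖ := by positivity
    linarith
  have hev := eventually_taylor_remainder_le (G := G) (hGs.of_le (by exact_mod_cast le_top))
    (c := fun w : Fin k → Phase d => a x + b w) (by fun_prop) p.1.isCompact hδ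
  have ha : Filter.Tendsto a (𝓝 0) (𝓝 0) := by simpa using a.continuous.tendsto 0
  filter_upwards [ha.eventually hev] with u hu
  have hrem : slice hf (x + u) - slice hf x - slice (hf.fderiv u) x =
      slice (((hf.translate u).sub hf).sub (hf.fderiv u)) x := by
    refine Obs.ext fun w => ?_
    change f (a (x + u) + b w) - f (a x + b w) - _ = f (a u + (a x + b w)) - f (a x + b w) - _
    rw [map_add, add_comm (a x) (a u), add_assoc]
    rfl
  have key : Obs.seminorms d k p (slice hf (x + u) - slice hf x - slice (hf.fderiv u) x) ≤
      ‖b‖ ^ p.2 * (δ * ‖a u‖) := by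
    rw [hrem]
    refine seminorms_slice_le _ x p (by positivity) fun w hw => ?_
    have hi : ∀ h : W → ℝ, ContDiff ℝ ∞ h → ContDiffAt ℝ p.2 h (a x + b w) :=
      fun h hh => (hh.of_le (by exact_mod_cast le_top)).contDiffAt
    have e1 := iteratedFDeriv_sub_apply (hi _ ((hf.translate u).sub hf).smooth)
      (hi _ (hf.fderiv u).smooth)
    have e2 := iteratedFDeriv_sub_apply (hi _ (hf.translate u).smooth) (hi _ hf.smooth)
    have e3 : iteratedFDeriv ℝ p.2 (fun z => f (a u + z) - f z - _root_.fderiv ℝ f z (a u))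
        (a x + b w) = G (a u + (a x + b w)) - G (a x + b w)
          - _root_.fderiv ℝ G (a x + b w) (a u) := by
      refine e1.trans ?_
      refine congrArg₂ _ (e2.trans ?_) (iteratedFDeriv_fderiv_apply hf.smooth _ _ _)
      rw [iteratedFDeriv_comp_add_left]
    rw [e3]
    exact hu w hw
  rw [sub_zero, map_smul_eq_mul, norm_inv, norm_norm]
  rcases eq_or_ne u 0 with rfl | hu0
  · simpa using hε
  have hup : 0 < ‖u‖ := norm_pos_iff.2 hu0
  rw [inv_mul_lt_iff₀ hup]
  calc _ ≤ ‖b‖ ^ p.2 * (δ * ‖a u‖) := key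
    _ ≤ ‖b‖ ^ p.2 * (δ * (‖a‖ * ‖u‖)) := by gcongr; exact a.le_opNorm u
    _ = ‖u‖ * (‖b‖ ^ p.2 * (δ * ‖a‖)) := by ring
    _ < ‖u‖ * ε := by gcongr

end Slice

/-! ### Smooth dependence of pairings on a parameter -/

section Parameter

variable {d k : ℕ} {P W : Type*} [NormedAddCommGroup P] [NormedSpace ℝ P]
  [NormedAddCommGroup W] [NormedSpace ℝ W]
  {a : P →L[ℝ] W} {b : (Fin k → Phase d) →L[ℝ] W} {f g : W → ℝ}

theorem slice_congr (hf : IsSymFamily a b f) (hg : IsSymFamily a b g) (h : f = g) (x : P) :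
    slice hf x = slice hg x := by subst h; rfl

theorem slice_fderiv_add (hf : IsSymFamily a b f) (x u v : P) :
    slice (hf.fderiv (u + v)) x = slice (hf.fderiv u) x + slice (hf.fderiv v) x :=
  Obs.ext fun w => by
    change fderiv ℝ f _ (a (u + v)) = fderiv ℝ f _ (a u) + fderiv ℝ f _ (a v)
    rw [map_add, map_add]

theorem slice_fderiv_smul (hf : IsSymFamily a b f) (x u : P) (c : ℝ) :
    slice (hf.fderiv (c • u)) x = c • slice (hf.fderiv u) x :=
  Obs.ext fun w => by
    change fderiv ℝ f _ (a (c • u)) = c • fderiv ℝ f _ (a u)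
    rw [map_smul, map_smul]

variable [FiniteDimensional ℝ P]

/-- The derivative of `x ↦ ⟨w ↦ f (a x + b w), ν⟩`. -/
noncomputable def familyDeriv (ν : State d k) (hf : IsSymFamily a b f) (x : P) : P →L[ℝ] ℝ :=
  LinearMap.toContinuousLinearMap
    { toFun := fun u => ν (slice (hf.fderiv u) x)
      map_add' := fun u v => by rw [slice_fderiv_add hf, map_add]
      map_smul' := fun c u => by rw [slice_fderiv_smul hf, map_smul]; rfl }

theorem familyDeriv_apply (ν : State d k) (hf : IsSymFamily a b f) (x u : P) :
    familyDeriv ν hf x u = ν (slice (hf.fderiv u) x) := rfl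

/-- A state may be differentiated under the pairing. -/
theorem hasFDerivAt_family (ν : State d k) (hf : IsSymFamily a b f) (x : P) :
    HasFDerivAt (fun y => ν (slice hf y)) (familyDeriv ν hf x) x := by
  rw [hasFDerivAt_iff_tendsto]
  have h := (ν.continuous.tendsto 0).comp (tendsto_slice_remainder hf x)
  rw [map_zero] at h
  have h2 := (tendsto_zero_iff_norm_tendsto_zero.1 h).comp
    (show Filter.Tendsto (fun y => y - x) (𝓝 x) (𝓝 0) from
      (continuous_id.sub continuous_const).tendsto' _ _ (sub_self x))
  refine h2.congr fun y => ?_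
  rw [familyDeriv_apply]
  simp only [Function.comp_apply, map_smul, add_sub_cancel, norm_smul, norm_inv, norm_norm]
  rw [map_sub, map_sub]

theorem fderiv_family_apply (ν : State d k) (hf : IsSymFamily a b f) (x u : P) :
    fderiv ℝ (fun y => ν (slice hf y)) x u = ν (slice (hf.fderiv u) x) := by
  rw [(hasFDerivAt_family ν hf x).fderiv, familyDeriv_apply]

theorem contDiff_family (ν : State d k) (hf : IsSymFamily a b f) :
    ContDiff ℝ ∞ fun x => ν (slice hf x) := by
  rw [contDiff_infty]
  intro n
  induction n generalizing f with
  | zero =>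
    rw [Nat.cast_zero, contDiff_zero]
    exact continuous_iff_continuousAt.2 fun x => (hasFDerivAt_family ν hf x).continuousAt
  | succ n ih =>
    rw [Nat.cast_succ, contDiff_succ_iff_fderiv_apply]
    refine ⟨fun x => (hasFDerivAt_family ν hf x).differentiableAt, by simp, fun u => ?_⟩
    simp only [fderiv_family_apply]
    exact ih (hf.fderiv u)

/-- Iterated derivatives in the parameter pass under the pairing with a state. -/
theorem dirDeriv_family (ν : State d k) (hf : IsSymFamily a b f) {i : ℕ} (h : Fin i → P) :
    dirDeriv h (fun x => ν (slice hf x)) = fun x => ν (slice (hf.dirDeriv h) x) := by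
  induction i with
  | zero =>
    rw [dirDeriv_zero]
    funext x
    rw [slice_congr _ hf (dirDeriv_zero _ f)]
  | succ i ih =>
    rw [dirDeriv_succ (contDiff_family ν hf), ih]
    funext x
    rw [fderiv_family_apply]
    exact congrArg ν (slice_congr _ _ (dirDeriv_succ hf.smooth fun l => a (h l)).symm x)

end Parameter

section Norm

/-- The norm of a multilinear form is controlled by its values on the unit ball. -/
theorem norm_multilinear_le_of_forall_norm_le_one {E : Type*} [NormedAddCommGroup E]
    [NormedSpace ℝ E] {i : ℕ} (T : E [×i]→L[ℝ] ℝ) {C : ℝ} (hC : 0 ≤ C)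
    (h : ∀ m : Fin i → E, (∀ l, ‖m l‖ ≤ 1) → ‖T m‖ ≤ C) : ‖T‖ ≤ C := by
  refine T.opNorm_le_bound hC fun m => ?_
  by_cases hm : ∃ l, m l = 0
  · obtain ⟨l, hl⟩ := hm
    rw [T.map_coord_zero l hl, norm_zero]
    positivity
  · push Not at hm
    have e : m = fun l => ‖m l‖ • (‖m l‖⁻¹ • m l) := by
      funext l
      rw [smul_smul, mul_inv_cancel₀ (norm_ne_zero_iff.2 (hm l)), one_smul]
    have h1 := h (fun l => ‖m l‖⁻¹ • m l) fun l => by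
      rw [norm_smul, norm_inv, norm_norm, inv_mul_cancel₀ (norm_ne_zero_iff.2 (hm l))]
    conv_lhs => rw [e, T.map_smul_univ]
    rw [norm_smul, mul_comm, norm_prod]
    simp only [norm_norm]
    gcongr

end Norm

/-! ### Partial pairings and tensor products of states -/

section Tensor

variable {d k : ℕ}

/-- Places a particle in position `0` of a configuration of `k + 1` particles, filling up
with zeros. -/
noncomputable def firstIn (d k : ℕ) : (Fin 1 → Phase d) →L[ℝ] (Fin (k + 1) → Phase d) :=
  ContinuousLinearMap.pi fun i => Fin.cases (ContinuousLinearMap.proj 0) (fun _ => 0) i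

/-- Places `k` particles in positions `1, …, k` of a configuration of `k + 1` particles, with zero
in position `0`. -/
noncomputable def restIn (d k : ℕ) : (Fin k → Phase d) →L[ℝ] (Fin (k + 1) → Phase d) :=
  ContinuousLinearMap.pi fun i => Fin.cases 0 (fun j => ContinuousLinearMap.proj j) i

theorem firstIn_add_restIn (z : Fin 1 → Phase d) (w : Fin k → Phase d) :
    firstIn d k z + restIn d k w = Fin.cons (z 0) w := by
  funext i
  refine Fin.cases ?_ (fun j => ?_) i <;> simp [firstIn, restIn]

theorem firstIn_eq_single (u : Phase d) :
    firstIn d k (Pi.single 0 u) = Pi.single 0 u := by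
  funext i
  refine Fin.cases ?_ (fun j => ?_) i <;> simp [firstIn]

theorem norm_firstIn_le (z : Fin 1 → Phase d) : ‖firstIn d k z‖ ≤ ‖z‖ := by
  refine (pi_norm_le_iff_of_nonneg (norm_nonneg _)).2 fun i => ?_
  refine Fin.cases ?_ (fun j => ?_) i
  · exact norm_le_pi_norm z 0
  · simp [firstIn]

theorem norm_restIn_le : ‖restIn d k‖ ≤ 1 := by
  refine ContinuousLinearMap.opNorm_le_bound _ zero_le_one fun w => ?_
  rw [one_mul]
  refine (pi_norm_le_iff_of_nonneg (norm_nonneg _)).2 fun i => ?_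
  refine Fin.cases ?_ (fun j => ?_) i
  · simp [restIn]
  · exact norm_le_pi_norm w j

/-- The last `k` particles of an observable of `k + 1` particles may be permuted among
themselves. -/
theorem Obs.isSymFamily_head (f : Obs d (k + 1)) :
    IsSymFamily (firstIn d k) (restIn d k) (f : (Fin (k + 1) → Phase d) → ℝ) where
  smooth := f.contDiff
  symm z π w := by
    rw [firstIn_add_restIn, firstIn_add_restIn,
      ← f.symm (Equiv.Perm.decomposeFin.symm (0, π)) (Fin.cons (z 0) w)]
    have e : (Fin.cons (z 0) (w ∘ π) : Fin (k + 1) → Phase d) =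
        Fin.cons (z 0) w ∘ Equiv.Perm.decomposeFin.symm (0, π) := by
      funext i
      refine Fin.cases ?_ (fun j => ?_) i <;> simp
    rw [e]

/-- The observable `f (z, ·)` of the last `k` particles of `f ∈ 𝔤_{k+1}`. -/
noncomputable abbrev tailObs (f : Obs d (k + 1)) (z : Fin 1 → Phase d) : Obs d k :=
  slice f.isSymFamily_head z

theorem tailObs_add (f g : Obs d (k + 1)) (z : Fin 1 → Phase d) :
    tailObs (f + g) z = tailObs f z + tailObs g z := rfl

theorem tailObs_smul (c : ℝ) (f : Obs d (k + 1)) (z : Fin 1 → Phase d) :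
    tailObs (c • f) z = c • tailObs f z := rfl

/-- The one-particle observable `z ↦ ⟨f (z, ·), ν⟩`, linear in `f`. -/
noncomputable def partialPairing (ν : State d k) : Obs d (k + 1) →ₗ[ℝ] Obs d 1 where
  toFun f := Obs.mk (fun z => ν (tailObs f z)) (contDiff_family ν f.isSymFamily_head)
    (fun π z => by rw [Subsingleton.elim π 1]; rfl)
  map_add' f g := Obs.ext fun z => (congrArg ν (tailObs_add f g z)).trans (map_add ν _ _)
  map_smul' c f := Obs.ext fun z => (congrArg ν (tailObs_smul c f z)).trans (map_smul ν _ _)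

theorem partialPairing_apply (ν : State d k) (f : Obs d (k + 1)) (z : Fin 1 → Phase d) :
    partialPairing ν f z = ν (tailObs f z) := rfl

/-- The compact set of all configurations of a particle in `K` and `k` particles in `L`. -/
noncomputable def consCompacts (K : TopologicalSpace.Compacts (Fin 1 → Phase d))
    (L : TopologicalSpace.Compacts (Fin k → Phase d)) :
    TopologicalSpace.Compacts (Fin (k + 1) → Phase d) :=
  (K ×ˢ L).map (fun q => firstIn d k q.1 + restIn d k q.2) (by fun_prop)

theorem mem_consCompacts {K : TopologicalSpace.Compacts (Fin 1 → Phase d)}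
    {L : TopologicalSpace.Compacts (Fin k → Phase d)} {z : Fin 1 → Phase d} {w : Fin k → Phase d}
    (hz : z ∈ K) (hw : w ∈ L) : firstIn d k z + restIn d k w ∈ consCompacts K L :=
  ⟨(z, w), ⟨hz, hw⟩, rfl⟩

theorem seminorms_slice_dirDeriv_le (f : Obs d (k + 1)) {i : ℕ} {h : Fin i → Fin 1 → Phase d}
    (hh : ∀ l, ‖h l‖ ≤ 1) {K : TopologicalSpace.Compacts (Fin 1 → Phase d)} {z : Fin 1 → Phase d}
    (hz : z ∈ K) (q : TopologicalSpace.Compacts (Fin k → Phase d) × ℕ) :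
    Obs.seminorms d k q (slice (f.isSymFamily_head.dirDeriv h) z) ≤
      Obs.seminorms d (k + 1) (consCompacts K q.1, i + q.2) f := by
  have hnn : 0 ≤ Obs.seminorms d (k + 1) (consCompacts K q.1, i + q.2) f := apply_nonneg _ _
  refine (seminorms_slice_le _ z q hnn fun w hw => ?_).trans
    (mul_le_of_le_one_left hnn (pow_le_one₀ (norm_nonneg _) norm_restIn_le))
  refine (norm_iteratedFDeriv_dirDeriv_le f.contDiff _
    (fun l => (norm_firstIn_le _).trans (hh l)) _ _).trans ?_
  exact Obs.norm_iteratedFDeriv_le_seminorms (consCompacts K q.1, i + q.2) f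
    (mem_consCompacts hz hw)

theorem dirDeriv_partialPairing (ν : State d k) (f : Obs d (k + 1)) {i : ℕ}
    (h : Fin i → Fin 1 → Phase d) (z : Fin 1 → Phase d) :
    iteratedFDeriv ℝ i (partialPairing ν f) z h = ν (slice (f.isSymFamily_head.dirDeriv h) z) :=
  congrFun (dirDeriv_family ν f.isSymFamily_head h) z

theorem seminorms_partialPairing_le (ν : State d k) (f : Obs d (k + 1))
    (p : TopologicalSpace.Compacts (Fin 1 → Phase d) × ℕ) {C : ℝ} (hC : 0 ≤ C)
    (h : ∀ z ∈ p.1, ∀ m : Fin p.2 → Fin 1 → Phase d, (∀ l, ‖m l‖ ≤ 1) →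
      |ν (slice (f.isSymFamily_head.dirDeriv m) z)| ≤ C) :
    Obs.seminorms d 1 p (partialPairing ν f) ≤ C := by
  refine Obs.seminorms_le p _ hC fun z hz => ?_
  refine norm_multilinear_le_of_forall_norm_le_one _ hC fun m hm => ?_
  rw [dirDeriv_partialPairing]
  exact h z hz m hm

/-- A state is bounded by finitely many of the seminorms. -/
theorem State.exists_bound (ν : State d k) :
    ∃ (s : Finset (TopologicalSpace.Compacts (Fin k → Phase d) × ℕ)) (C : ℝ), 0 ≤ C ∧
      ∀ φ, |ν φ| ≤ C * ∑ q ∈ s, Obs.seminorms d k q φ := by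
  obtain ⟨s, C, -, h⟩ := Seminorm.bound_of_continuous (Obs.withSeminorms d k)
    ((normSeminorm ℝ ℝ).comp (ν : Obs d k →ₗ[ℝ] ℝ)) (continuous_norm.comp ν.continuous)
  refine ⟨s, C, C.2, fun φ => (h φ).trans ?_⟩
  refine mul_le_mul_of_nonneg_left ?_ C.2
  refine Seminorm.finset_sup_apply_le (Finset.sum_nonneg fun q _ => apply_nonneg _ _) fun q hq => ?_
  exact Finset.single_le_sum (f := fun q => Obs.seminorms d k q φ)
    (fun q _ => apply_nonneg _ _) hq

open Classical in
/-- The partial pairing is controlled on `K` up to order `i` by the seminorms of order `i + j` on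
`K × L`, where `(L, j)` runs over the finitely many seminorms that bound `ν`. -/
theorem continuous_partialPairing (ν : State d k) : Continuous (partialPairing ν) := by
  refine WithSeminorms.continuous_of_isBounded (Obs.withSeminorms d (k + 1))
    (Obs.withSeminorms d 1) _ fun p => ?_
  obtain ⟨s, C, hC, hν⟩ := ν.exists_bound
  refine ⟨s.image fun q => (consCompacts p.1 q.1, p.2 + q.2), ⟨C * s.card, by positivity⟩,
    fun f => ?_⟩
  set t := s.image fun q => (consCompacts p.1 q.1, p.2 + q.2)
  set M := t.sup (Obs.seminorms d (k + 1)) f with hM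
  have hM0 : 0 ≤ M := apply_nonneg _ _
  change Obs.seminorms d 1 p (partialPairing ν f) ≤ C * s.card * M
  refine seminorms_partialPairing_le ν f p (by positivity) fun z hz m hm => ?_
  refine (hν _).trans ?_
  rw [mul_assoc, ← nsmul_eq_mul]
  refine mul_le_mul_of_nonneg_left (Finset.sum_le_card_nsmul _ _ _ fun q hq => ?_) hC
  refine (seminorms_slice_dirDeriv_le f hm hz q).trans ?_
  exact Seminorm.le_finset_sup_apply (Finset.mem_image_of_mem _ hq)

/-- The tensor product `γ ⊗ ν`: the state `f ↦ ⟨z ↦ ⟨f (z, ·), ν⟩, γ⟩`. -/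
noncomputable def tensor (γ : State d 1) (ν : State d k) : State d (k + 1) :=
  γ.comp ⟨partialPairing ν, continuous_partialPairing ν⟩

theorem tensor_apply (γ : State d 1) (ν : State d k) (f : Obs d (k + 1)) :
    tensor γ ν f = γ (partialPairing ν f) := rfl

end Tensor

/-! ### Continuity of bilinear maps and a scaling lemma -/

section Bilinear

/-- Every vector has a nonzero multiple in a given neighbourhood of the origin. -/
theorem exists_smul_mem_of_mem_nhds_zero {E : Type*} [AddCommGroup E] [Module ℝ E]
    [TopologicalSpace E] [ContinuousSMul ℝ E] (x : E) {V : Set E} (hV : V ∈ 𝓝 (0 : E)) :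
    ∃ c : ℝ, c ≠ 0 ∧ c • x ∈ V := by
  have h1 : Filter.Tendsto (fun c : ℝ => c • x) (𝓝[≠] 0) (𝓝 0) :=
    ((continuous_id.smul continuous_const).tendsto' (0 : ℝ) (0 : E)
      (by simp)).mono_left nhdsWithin_le_nhds
  obtain ⟨c, hc, hc0⟩ := ((h1.eventually hV).and self_mem_nhdsWithin).exists
  exact ⟨c, hc0, hc⟩

theorem eventually_smul_mem_of_mem_nhds_zero {E : Type*} [AddCommGroup E] [Module ℝ E]
    [TopologicalSpace E] [ContinuousSMul ℝ E] (c : ℝ) {V : Set E} (hV : V ∈ 𝓝 (0 : E)) :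
    ∀ᶠ y in 𝓝 (0 : E), c • y ∈ V :=
  (continuous_const_smul c).tendsto' (0 : E) 0 (smul_zero c) hV

/-- A bilinear map between topological vector spaces is continuous as soon as it is jointly
continuous at the origin. -/
theorem continuous_bilinear_of_continuousAt_zero {E F G : Type*}
    [AddCommGroup E] [Module ℝ E] [TopologicalSpace E] [IsTopologicalAddGroup E]
    [ContinuousSMul ℝ E] [AddCommGroup F] [Module ℝ F] [TopologicalSpace F]
    [IsTopologicalAddGroup F] [ContinuousSMul ℝ F] [AddCommGroup G] [Module ℝ G]
    [TopologicalSpace G] [IsTopologicalAddGroup G] (B : E →ₗ[ℝ] F →ₗ[ℝ] G)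
    (h : ∀ U ∈ 𝓝 (0 : G), ∃ V₁ ∈ 𝓝 (0 : E), ∃ V₂ ∈ 𝓝 (0 : F), ∀ x ∈ V₁, ∀ y ∈ V₂, B x y ∈ U) :
    Continuous fun p : E × F => B p.1 p.2 := by
  let f : E →+ F →+ G :=
    { toFun := fun x => (B x).toAddMonoidHom
      map_zero' := by ext; simp
      map_add' := fun x y => by ext; simp }
  refine continuous_of_continuousAt_zero₂ f ?_ (fun x => ?_) (fun y => ?_)
  · intro U hU
    have hU' : U ∈ 𝓝 (0 : G) := by simpa [f] using hU
    obtain ⟨V₁, hV₁, V₂, hV₂, hV⟩ := h U hU'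
    exact Filter.mem_map.2 (Filter.mem_of_superset (prod_mem_nhds hV₁ hV₂)
      fun p hp => hV _ hp.1 _ hp.2)
  · intro U hU
    have hU' : U ∈ 𝓝 (0 : G) := by simpa [f] using hU
    obtain ⟨V₁, hV₁, V₂, hV₂, hV⟩ := h U hU'
    obtain ⟨c, hc0, hc⟩ := exists_smul_mem_of_mem_nhds_zero x hV₁
    refine Filter.mem_map.2 ?_
    filter_upwards [eventually_smul_mem_of_mem_nhds_zero c⁻¹ hV₂] with y hy
    have := hV _ hc _ hy
    rwa [map_smul, map_smul, LinearMap.smul_apply, smul_smul, inv_mul_cancel₀ hc0,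
      one_smul] at this
  · intro U hU
    have hU' : U ∈ 𝓝 (0 : G) := by simpa [f] using hU
    obtain ⟨V₁, hV₁, V₂, hV₂, hV⟩ := h U hU'
    obtain ⟨c, hc0, hc⟩ := exists_smul_mem_of_mem_nhds_zero y hV₂
    refine Filter.mem_map.2 ?_
    filter_upwards [eventually_smul_mem_of_mem_nhds_zero c⁻¹ hV₁] with x hx
    have := hV _ hx _ hc
    rwa [map_smul, map_smul, LinearMap.smul_apply, smul_smul, mul_inv_cancel₀ hc0,
      one_smul] at this

/-- Mackey's countability argument: the rows of an infinite matrix can be rescaled so that every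
column becomes bounded. -/
theorem exists_scaling_bounded (r : ℕ → ℕ → ℝ) (hr : ∀ n m, 0 ≤ r n m) :
    ∃ c : ℕ → ℝ, (∀ n, 0 < c n) ∧ ∀ m, ∃ R, ∀ n, c n * r n m ≤ R := by
  have hpos : ∀ n, 0 < 1 + ∑ m ∈ Finset.range (n + 1), r n m := fun n =>
    add_pos_of_pos_of_nonneg one_pos (Finset.sum_nonneg fun m _ => hr n m)
  refine ⟨fun n => (1 + ∑ m ∈ Finset.range (n + 1), r n m)⁻¹, fun n => inv_pos.2 (hpos n),
    fun m => ⟨1 + ∑ n ∈ Finset.range m, r n m, fun n => ?_⟩⟩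
  have hs : 0 ≤ ∑ n ∈ Finset.range m, r n m := Finset.sum_nonneg fun n _ => hr n m
  rcases lt_or_ge n m with hnm | hnm
  · have h1 : r n m ≤ ∑ n ∈ Finset.range m, r n m :=
      Finset.single_le_sum (f := fun n => r n m) (fun n _ => hr n m) (Finset.mem_range.2 hnm)
    have h2 : (1 + ∑ m ∈ Finset.range (n + 1), r n m)⁻¹ ≤ 1 :=
      inv_le_one_of_one_le₀ (le_add_of_nonneg_right (Finset.sum_nonneg fun m _ => hr n m))
    have h3 := mul_le_of_le_one_left (hr n m) h2
    linarith
  · have h1 : r n m ≤ ∑ m ∈ Finset.range (n + 1), r n m :=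
      Finset.single_le_sum (f := fun m => r n m) (fun m _ => hr n m)
        (Finset.mem_range.2 (Nat.lt_succ_of_le hnm))
    have h2 : (1 + ∑ m ∈ Finset.range (n + 1), r n m)⁻¹ * r n m ≤ 1 := by
      rw [inv_mul_le_iff₀ (hpos n)]
      linarith
    linarith

end Bilinear

/-! ### Joint continuity of the tensor product in the strong topologies -/

section TensorContinuous

variable {d k : ℕ}

/-- The closed ball of radius `n` around the origin in the space of `k` particles. -/
noncomputable def ballCompacts (d k n : ℕ) : TopologicalSpace.Compacts (Fin k → Phase d) :=
  ⟨Metric.closedBall 0 n, isCompact_closedBall _ _⟩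

theorem exists_le_ballCompacts (K : TopologicalSpace.Compacts (Fin k → Phase d)) (i : ℕ) :
    ∃ n, i ≤ n ∧ ∀ z ∈ K, z ∈ ballCompacts d k n := by
  obtain ⟨r, hr⟩ := K.isCompact.isBounded.subset_closedBall 0
  obtain ⟨n, hn⟩ := exists_nat_ge (max r i)
  refine ⟨n, by exact_mod_cast (le_max_right r (i : ℝ)).trans hn, fun z hz => ?_⟩
  exact Metric.closedBall_subset_closedBall ((le_max_left r (i : ℝ)).trans hn) (hr hz)

theorem Obs.seminorms_mono {K L : TopologicalSpace.Compacts (Fin k → Phase d)}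
    (h : ∀ z ∈ K, z ∈ L) (i : ℕ) (φ : Obs d k) :
    Obs.seminorms d k (K, i) φ ≤ Obs.seminorms d k (L, i) φ :=
  Obs.seminorms_le (K, i) φ (apply_nonneg _ _) fun z hz =>
    Obs.norm_iteratedFDeriv_le_seminorms (L, i) φ (h z hz)

/-- The derivatives `D^i f (z, ·) (h)` with `i ≤ n`, `‖z‖ ≤ n`, `‖h‖ ≤ 1`, for `f` in `S`. -/
def headJets (S : Set (Obs d (k + 1))) (n : ℕ) : Set (Obs d k) :=
  {ψ | ∃ f ∈ S, ∃ i ≤ n, ∃ h : Fin i → Fin 1 → Phase d, (∀ l, ‖h l‖ ≤ 1) ∧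
    ∃ z ∈ ballCompacts d 1 n, ψ = slice (f.isSymFamily_head.dirDeriv h) z}

/-- The derivatives of a bounded set of observables form bounded sets. The bound `r n m` is uniform
in the derivatives up to order `m` on the ball of radius `m`. -/
theorem exists_bound_headJets {S : Set (Obs d (k + 1))} (hS : Bornology.IsVonNBounded ℝ S) :
    ∃ r : ℕ → ℕ → ℝ, (∀ n m, 0 ≤ r n m) ∧ ∀ n m, ∀ ψ ∈ headJets S n, ∀ j ≤ m,
      Obs.seminorms d k (ballCompacts d k m, j) ψ ≤ r n m := by
  rw [(Obs.withSeminorms d (k + 1)).isVonNBounded_iff_seminorm_bounded] at hS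
  choose R hR0 hR using hS
  refine ⟨fun n m => ∑ l ∈ Finset.range (n + m + 1),
      R (consCompacts (ballCompacts d 1 n) (ballCompacts d k m), l),
    fun n m => Finset.sum_nonneg fun l _ => (hR0 _).le, ?_⟩
  rintro n m ψ ⟨f, hf, i, hi, h, hh, z, hz, rfl⟩ j hj
  refine (seminorms_slice_dirDeriv_le f hh hz _).trans ((hR _ f hf).le.trans ?_)
  exact Finset.single_le_sum
    (f := fun l => R (consCompacts (ballCompacts d 1 n) (ballCompacts d k m), l))
    (fun l _ => (hR0 _).le) (Finset.mem_range.2 (by omega))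

/-- For a bounded set `S` of observables there is a bounded set `B` such that the partial pairings of
the elements of `S` with all states of absolute value at most `1` on `B` form a bounded set. -/
theorem exists_bounded_partialPairing {S : Set (Obs d (k + 1))}
    (hS : Bornology.IsVonNBounded ℝ S) :
    ∃ B : Set (Obs d k), Bornology.IsVonNBounded ℝ B ∧
      Bornology.IsVonNBounded ℝ {φ : Obs d 1 | ∃ f ∈ S, ∃ ν : State d k,
        (∀ ψ ∈ B, |ν ψ| ≤ 1) ∧ φ = partialPairing ν f} := by
  obtain ⟨r, hr0, hr⟩ := exists_bound_headJets hS
  obtain ⟨c, hc0, hc⟩ := exists_scaling_bounded r hr0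
  -- `B` is the union of the rescaled sets `c n • headJets S n`; a state bounded by `1` on `B` is
  -- bounded by `(c n)⁻¹` on the derivatives up to order `n` over the ball of radius `n`
  refine ⟨{φ | ∃ n, ∃ ψ ∈ headJets S n, φ = c n • ψ}, ?_, ?_⟩
  · rw [(Obs.withSeminorms d k).isVonNBounded_iff_seminorm_bounded]
    rintro ⟨K, j⟩
    obtain ⟨m, hjm, hKm⟩ := exists_le_ballCompacts K j
    obtain ⟨R, hR⟩ := hc m
    refine ⟨max R 0 + 1, by positivity, ?_⟩
    rintro _ ⟨n, ψ, hψ, rfl⟩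
    rw [map_smul_eq_mul, Real.norm_of_nonneg (hc0 n).le]
    calc c n * Obs.seminorms d k (K, j) ψ ≤ c n * r n m :=
          mul_le_mul_of_nonneg_left ((Obs.seminorms_mono hKm j ψ).trans (hr n m ψ hψ j hjm))
            (hc0 n).le
      _ ≤ R := hR n
      _ < max R 0 + 1 := lt_of_le_of_lt (le_max_left _ _) (lt_add_one _)
  · rw [(Obs.withSeminorms d 1).isVonNBounded_iff_seminorm_bounded]
    rintro ⟨K, i⟩
    obtain ⟨n, hin, hKn⟩ := exists_le_ballCompacts K i
    have hcn := hc0 n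
    refine ⟨(c n)⁻¹ + 1, by positivity, ?_⟩
    rintro _ ⟨f, hf, ν, hν, rfl⟩
    refine lt_of_le_of_lt (seminorms_partialPairing_le ν f (K, i) (inv_pos.2 hcn).le
      fun z hz h hh => ?_) (lt_add_one _)
    have := hν _ ⟨n, _, ⟨f, hf, i, hin, h, hh, z, hKn z hz, rfl⟩, rfl⟩
    rw [map_smul, smul_eq_mul, abs_mul, abs_of_pos hcn] at this
    rwa [← mul_one (c n)⁻¹, le_inv_mul_iff₀ hcn]

theorem tensor_add_left (γ γ' : State d 1) (ν : State d k) :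
    tensor (γ + γ') ν = tensor γ ν + tensor γ' ν := rfl

theorem tensor_smul_left (c : ℝ) (γ : State d 1) (ν : State d k) :
    tensor (c • γ) ν = c • tensor γ ν := rfl

theorem tensor_add_right (γ : State d 1) (ν ν' : State d k) :
    tensor γ (ν + ν') = tensor γ ν + tensor γ ν' := by
  ext f
  exact map_add γ (partialPairing ν f) (partialPairing ν' f)

theorem tensor_smul_right (c : ℝ) (γ : State d 1) (ν : State d k) :
    tensor γ (c • ν) = c • tensor γ ν := by
  ext f
  exact map_smul γ c (partialPairing ν f)

/-- The tensor product of states as a bilinear map. -/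
noncomputable def tensorBilin (d k : ℕ) : State d 1 →ₗ[ℝ] State d k →ₗ[ℝ] State d (k + 1) :=
  LinearMap.mk₂ ℝ tensor tensor_add_left tensor_smul_left tensor_add_right
    fun c γ ν => tensor_smul_right c γ ν

theorem tensorBilin_apply (γ : State d 1) (ν : State d k) :
    tensorBilin d k γ ν = tensor γ ν := rfl

/-- The tensor product of states is jointly continuous for the strong topologies. -/
theorem continuous_tensorBilin (d k : ℕ) :
    Continuous fun p : State d 1 × State d k => tensorBilin d k p.1 p.2 := by
  refine continuous_bilinear_of_continuousAt_zero _ fun U hU => ?_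
  obtain ⟨⟨S, V⟩, ⟨hS, hV⟩, hSV⟩ := ContinuousLinearMap.hasBasis_nhds_zero.mem_iff.1 hU
  obtain ⟨B, hB, hB'⟩ := exists_bounded_partialPairing hS
  refine ⟨_, ContinuousLinearMap.hasBasis_nhds_zero.mem_of_mem (i := (_, V)) ⟨hB', hV⟩,
    _, ContinuousLinearMap.hasBasis_nhds_zero.mem_of_mem (i := (B, Metric.closedBall 0 1))
      ⟨hB, Metric.closedBall_mem_nhds _ one_pos⟩, fun γ hγ ν hν => hSV fun f hf => ?_⟩
  exact hγ _ ⟨f, hf, ν, fun ψ hψ => by simpa using hν ψ hψ, rfl⟩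

end TensorContinuous

/-! ### Fubini's theorem for functionals on spaces of continuous functions -/

section FunctionalFubini

variable {X Y : Type*} [MetricSpace X] [MetricSpace Y]

/-- The functional `g ↦ ⟨x ↦ ⟨g (x, ·), M⟩, Λ⟩` on `C(X × Y)`. -/
noncomputable def iteratedFunctional (Λ : C(X, ℝ) →L[ℝ] ℝ) (M : C(Y, ℝ) →L[ℝ] ℝ) :
    C(X × Y, ℝ) →ₗ[ℝ] ℝ where
  toFun g := Λ ((⟨M, M.continuous⟩ : C(C(Y, ℝ), ℝ)).comp g.curry)
  map_add' g g' := by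
    rw [← map_add]
    congr 1
    ext x
    exact map_add M (g.curry x) (g'.curry x)
  map_smul' c g := by
    rw [RingHom.id_apply, ← map_smul]
    congr 1
    ext x
    exact map_smul M c (g.curry x)

theorem iteratedFunctional_apply (Λ : C(X, ℝ) →L[ℝ] ℝ) (M : C(Y, ℝ) →L[ℝ] ℝ) (g : C(X × Y, ℝ)) :
    iteratedFunctional Λ M g = Λ ((⟨M, M.continuous⟩ : C(C(Y, ℝ), ℝ)).comp g.curry) := rfl

variable [CompactSpace X] [CompactSpace Y]

theorem continuous_iteratedFunctional (Λ : C(X, ℝ) →L[ℝ] ℝ) (M : C(Y, ℝ) →L[ℝ] ℝ) :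
    Continuous (iteratedFunctional Λ M) :=
  Λ.continuous.comp ((ContinuousMap.continuous_postcomp _).comp ContinuousMap.continuous_curry)

/-- The functions `(x, y) ↦ u x * v y` on `X × Y`. -/
def productFunctions (X Y : Type*) [TopologicalSpace X] [TopologicalSpace Y] :
    Submonoid C(X × Y, ℝ) where
  carrier := {g | ∃ (u : C(X, ℝ)) (v : C(Y, ℝ)), g = u.comp .fst * v.comp .snd}
  one_mem' := ⟨1, 1, by ext; simp⟩
  mul_mem' := by
    rintro _ _ ⟨u, v, rfl⟩ ⟨u', v', rfl⟩
    exact ⟨u * u', v * v', by ext; simp; ring⟩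

/-- Sums of products of functions of one variable are dense, by the Stone–Weierstrass theorem. -/
theorem topologicalClosure_adjoin_productFunctions :
    (Algebra.adjoin ℝ (productFunctions X Y : Set C(X × Y, ℝ))).topologicalClosure = ⊤ := by
  refine ContinuousMap.subalgebra_topologicalClosure_eq_top_of_separatesPoints _ ?_
  intro p q hpq
  by_cases h1 : p.1 = q.1
  · have h2 : p.2 ≠ q.2 := fun h2 => hpq (Prod.ext h1 h2)
    refine ⟨_, ⟨_, Algebra.subset_adjoin ⟨1, ⟨fun y => dist y q.2, by fun_prop⟩, rfl⟩, rfl⟩, ?_⟩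
    simpa using h2
  · refine ⟨_, ⟨_, Algebra.subset_adjoin ⟨⟨fun x => dist x q.1, by fun_prop⟩, 1, rfl⟩, rfl⟩, ?_⟩
    simpa using h1

/-- Fubini's theorem for continuous functionals on spaces of continuous functions: it is plain for
products `u x * v y`, whose linear combinations are dense by the Stone–Weierstrass theorem. -/
theorem iteratedFunctional_comm (Λ : C(X, ℝ) →L[ℝ] ℝ) (M : C(Y, ℝ) →L[ℝ] ℝ) (g : C(X × Y, ℝ)) :
    iteratedFunctional Λ M g = iteratedFunctional M Λ (g.comp .prodSwap) := by
  have hclosed : IsClosed {g : C(X × Y, ℝ) |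
      iteratedFunctional Λ M g = iteratedFunctional M Λ (g.comp .prodSwap)} :=
    isClosed_eq (continuous_iteratedFunctional Λ M)
      ((continuous_iteratedFunctional M Λ).comp (ContinuousMap.continuous_precomp _))
  let swap : C(X × Y, ℝ) →ₗ[ℝ] C(Y × X, ℝ) :=
    { toFun := fun g => g.comp .prodSwap, map_add' := fun _ _ => rfl, map_smul' := fun _ _ => rfl }
  have hspan : Submodule.span ℝ (productFunctions X Y : Set C(X × Y, ℝ)) ≤
      LinearMap.eqLocus (iteratedFunctional Λ M) ((iteratedFunctional M Λ).comp swap) := by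
    rw [Submodule.span_le]
    rintro _ ⟨u, v, rfl⟩
    have e1 : iteratedFunctional Λ M (u.comp .fst * v.comp .snd) = M v • Λ u := by
      rw [iteratedFunctional_apply, ← map_smul]
      congr 1
      ext x
      have : (u.comp .fst * v.comp .snd : C(X × Y, ℝ)).curry x = u x • v := by ext y; rfl
      simp [this, mul_comm]
    have e2 : iteratedFunctional M Λ ((u.comp .fst * v.comp .snd : C(X × Y, ℝ)).comp .prodSwap)
        = Λ u • M v := by
      rw [iteratedFunctional_apply, ← map_smul]
      congr 1
      ext y
      have : ((u.comp .fst * v.comp .snd : C(X × Y, ℝ)).comp .prodSwap).curry y = v y • u := by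
        ext x; exact mul_comm _ _
      change Λ (((u.comp .fst * v.comp .snd : C(X × Y, ℝ)).comp .prodSwap).curry y) = Λ u * v y
      rw [this, map_smul, smul_eq_mul, mul_comm]
    refine e1.trans (Eq.trans ?_ e2.symm)
    rw [smul_eq_mul, smul_eq_mul, mul_comm]
  have hsub : (Algebra.adjoin ℝ (productFunctions X Y : Set C(X × Y, ℝ)) : Set C(X × Y, ℝ)) ⊆
      {g | iteratedFunctional Λ M g = iteratedFunctional M Λ (g.comp .prodSwap)} := by
    intro g hg
    have hg' : g ∈ Submodule.span ℝ (productFunctions X Y : Set C(X × Y, ℝ)) := by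
      rw [← Submonoid.closure_eq (productFunctions X Y), ← Algebra.adjoin_eq_span]
      exact hg
    exact hspan hg'
  have h := topologicalClosure_adjoin_productFunctions (X := X) (Y := Y)
  have hg : g ∈ (Algebra.adjoin ℝ
      (productFunctions X Y : Set C(X × Y, ℝ))).topologicalClosure := by
    rw [h]; trivial
  exact hclosed.closure_subset_iff.2 hsub hg

end FunctionalFubini

/-! ### States as functionals of derivatives on compact sets -/

section HahnBanach

/-- A linear functional dominated by the norm of a linear map `J` factors through `J`
continuously. -/
theorem exists_continuous_factor {E X : Type*} [AddCommGroup E] [Module ℝ E]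
    [NormedAddCommGroup X] [NormedSpace ℝ X] (J : E →ₗ[ℝ] X) (γ : E →ₗ[ℝ] ℝ) (C : ℝ)
    (h : ∀ φ, |γ φ| ≤ C * ‖J φ‖) : ∃ Λ : X →L[ℝ] ℝ, ∀ φ, Λ (J φ) = γ φ := by
  obtain ⟨r, hr⟩ := J.rangeRestrict.exists_rightInverse_of_surjective J.range_rangeRestrict
  -- `r` is a linear section of `J` over its range, so `γ ∘ r` is a bounded functional there
  have hr' : ∀ y : LinearMap.range J, J (r y) = y := fun y =>
    congrArg Subtype.val (LinearMap.congr_fun hr y)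
  let g : LinearMap.range J →L[ℝ] ℝ := (γ.comp r).mkContinuous C fun y => by
    simpa [hr'] using h (r y)
  obtain ⟨Λ, hΛ, -⟩ := _root_.exists_extension_norm_eq (LinearMap.range J) g
  refine ⟨Λ, fun φ => ?_⟩
  have h1 := hΛ ⟨J φ, φ, rfl⟩
  have h2 : γ (r ⟨J φ, φ, rfl⟩ - φ) = 0 := by
    have h3 := h (r ⟨J φ, φ, rfl⟩ - φ)
    rw [map_sub J, hr', sub_self, norm_zero, mul_zero] at h3
    exact abs_nonpos_iff.1 h3
  rw [map_sub, sub_eq_zero] at h2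
  exact h1.trans h2

end HahnBanach

section Jets

variable {d k : ℕ}

/-- The points `(z, h)`, with `z ∈ K` and `h` an `i`-tuple in the unit ball, at which the `i`-th
derivative of an observable is evaluated. -/
abbrev JetSpace (d k : ℕ) (p : TopologicalSpace.Compacts (Fin k → Phase d) × ℕ) : Type :=
  p.1 × (Fin p.2 → Metric.closedBall (0 : Fin k → Phase d) 1)

/-- The `i`-th derivative over `K` of an observable as the continuous function
`(z, h) ↦ D^i φ (z) (h)`, whose supremum is the seminorm for `(K, i)`. -/
noncomputable def jet (p : TopologicalSpace.Compacts (Fin k → Phase d) × ℕ) :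
    Obs d k →ₗ[ℝ] C(JetSpace d k p, ℝ) where
  toFun φ := ⟨fun q => dirDeriv (fun l => (q.2 l : Fin k → Phase d)) φ q.1, by
    have h := (contDiff_iteratedFDeriv φ.contDiff p.2).continuous
    unfold dirDeriv
    fun_prop⟩
  map_add' φ ψ := by
    ext q
    have := iteratedFDeriv_add_apply (i := p.2) (x := (q.1 : Fin k → Phase d))
      (φ.contDiff.of_le (by exact_mod_cast le_top)).contDiffAt
      (ψ.contDiff.of_le (by exact_mod_cast le_top)).contDiffAt
    exact congrArg (fun T => T fun l => (q.2 l : Fin k → Phase d)) this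
  map_smul' c φ := by
    ext q
    have := iteratedFDeriv_const_smul_apply (a := c) (i := p.2) (x := (q.1 : Fin k → Phase d))
      (φ.contDiff.of_le (by exact_mod_cast le_top)).contDiffAt
    exact congrArg (fun T => T fun l => (q.2 l : Fin k → Phase d)) this

theorem jet_apply (p : TopologicalSpace.Compacts (Fin k → Phase d) × ℕ) (φ : Obs d k)
    (q : JetSpace d k p) :
    jet p φ q = dirDeriv (fun l => (q.2 l : Fin k → Phase d)) φ q.1 := rfl

theorem seminorms_le_norm_jet (p : TopologicalSpace.Compacts (Fin k → Phase d) × ℕ)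
    (φ : Obs d k) : Obs.seminorms d k p φ ≤ ‖jet p φ‖ :=
  Obs.seminorms_le p φ (norm_nonneg _) fun z hz =>
    norm_multilinear_le_of_forall_norm_le_one _ (norm_nonneg _) fun m hm =>
      (jet p φ).norm_coe_le_norm
        (⟨z, hz⟩, fun l => ⟨m l, mem_closedBall_zero_iff.2 (hm l)⟩)

/-- By the Hahn–Banach theorem, every state is a finite sum of continuous functionals of the
derivatives over compact sets. -/
theorem State.exists_eq_sum_jet (γ : State d k) :
    ∃ (s : Finset (TopologicalSpace.Compacts (Fin k → Phase d) × ℕ))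
      (Λ : ∀ p : s, C(JetSpace d k p, ℝ) →L[ℝ] ℝ), ∀ φ, γ φ = ∑ p, Λ p (jet p φ) := by
  classical
  obtain ⟨s, C, hC, h⟩ := γ.exists_bound
  obtain ⟨Λ, hΛ⟩ := exists_continuous_factor
    (LinearMap.pi fun p : s => jet (p : TopologicalSpace.Compacts (Fin k → Phase d) × ℕ))
    (γ : Obs d k →ₗ[ℝ] ℝ) (C * s.card) fun φ => by
      refine (h φ).trans ?_
      rw [mul_assoc, ← nsmul_eq_mul]
      refine mul_le_mul_of_nonneg_left (Finset.sum_le_card_nsmul _ _ _ fun q hq => ?_) hC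
      refine (seminorms_le_norm_jet q φ).trans ?_
      exact norm_le_pi_norm (LinearMap.pi (fun p : s => jet
        (p : TopologicalSpace.Compacts (Fin k → Phase d) × ℕ)) φ) ⟨q, hq⟩
  refine ⟨s, fun p => Λ.comp (ContinuousLinearMap.single ℝ (fun p : s => C(JetSpace d k p, ℝ)) p), fun φ => ?_⟩
  have h1 := hΛ φ
  rw [← Finset.univ_sum_single (LinearMap.pi (fun p : s => jet
    (p : TopologicalSpace.Compacts (Fin k → Phase d) × ℕ)) φ), map_sum] at h1
  exact h1.symm

end Jets

/-! ### Fubini's theorem for states -/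

section Fubini

variable {d : ℕ} {W : Type*} [NormedAddCommGroup W] [NormedSpace ℝ W]
  {a b : (Fin 1 → Phase d) →L[ℝ] W} {f : W → ℝ}

theorem isSymFamily_one {P : Type*} [NormedAddCommGroup P] [NormedSpace ℝ P] {a : P →L[ℝ] W}
    (hf : ContDiff ℝ ∞ f) : IsSymFamily a b f where
  smooth := hf
  symm x π w := by rw [Subsingleton.elim π 1]; rfl

/-- The one-particle observable `x ↦ ⟨w ↦ f (a x + b w), ν⟩`. -/
noncomputable def familyObs (ν : State d 1) (hf : IsSymFamily a b f) : Obs d 1 :=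
  Obs.mk (fun x => ν (slice hf x)) (contDiff_family ν hf)
    (fun π z => by rw [Subsingleton.elim π 1]; rfl)

/-- The mixed derivatives of `f (a x + b y)` in `x` and `y`. -/
noncomputable def mixedJet (a b : (Fin 1 → Phase d) →L[ℝ] W) (hf : ContDiff ℝ ∞ f)
    (p q : TopologicalSpace.Compacts (Fin 1 → Phase d) × ℕ) :
    C(JetSpace d 1 p × JetSpace d 1 q, ℝ) :=
  ⟨fun r => dirDeriv (fun l => b (r.2.2 l)) (dirDeriv (fun l => a (r.1.2 l)) f)
      (a r.1.1 + b r.2.1), by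
    simp only [dirDeriv_dirDeriv_apply hf]
    have h := (((contDiff_iteratedFDeriv hf p.2).iteratedFDeriv_right (m := ∞) (i := q.2)
      (by exact_mod_cast le_top)).continuous)
    have h1 : Continuous fun r : JetSpace d 1 p × JetSpace d 1 q =>
      iteratedFDeriv ℝ q.2 (iteratedFDeriv ℝ p.2 f) (a r.1.1 + b r.2.1) := h.comp (by fun_prop)
    have h2 : Continuous fun r : JetSpace d 1 p × JetSpace d 1 q =>
      fun l => b (r.2.2 l : Fin 1 → Phase d) := by fun_prop
    have h3 : Continuous fun r : JetSpace d 1 p × JetSpace d 1 q =>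
      fun l => a (r.1.2 l : Fin 1 → Phase d) := by fun_prop
    fun_prop⟩

/-- Derivatives in `x` and in `y` commute. -/
theorem mixedJet_swap (hf : ContDiff ℝ ∞ f)
    (p q : TopologicalSpace.Compacts (Fin 1 → Phase d) × ℕ) :
    (mixedJet a b hf p q).comp .prodSwap = mixedJet b a hf q p := by
  ext r
  change dirDeriv _ (dirDeriv _ f) (a r.2.1 + b r.1.1) = _
  rw [dirDeriv_comm hf, add_comm]
  rfl

theorem jet_slice_dirDeriv (hf : ContDiff ℝ ∞ f)
    (p q : TopologicalSpace.Compacts (Fin 1 → Phase d) × ℕ) (r : JetSpace d 1 p) :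
    jet q (slice ((isSymFamily_one hf : IsSymFamily a b f).dirDeriv
      fun l => (r.2 l : Fin 1 → Phase d)) r.1) = (mixedJet a b hf p q).curry r := by
  ext t
  rw [jet_apply, dirDeriv, iteratedFDeriv_slice]
  rfl

/-- The iterated pairing with two states is a sum of iterated functionals of the mixed
derivatives: the derivatives in `x` pass under the pairing with `ν`. -/
theorem apply_familyObs_eq_sum (hf : ContDiff ℝ ∞ f) {γ ν : State d 1}
    {s t : Finset (TopologicalSpace.Compacts (Fin 1 → Phase d) × ℕ)}
    {Λ : ∀ p : s, C(JetSpace d 1 p, ℝ) →L[ℝ] ℝ} {M : ∀ p : t, C(JetSpace d 1 p, ℝ) →L[ℝ] ℝ}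
    (hγ : ∀ φ, γ φ = ∑ p, Λ p (jet p φ)) (hν : ∀ φ, ν φ = ∑ p, M p (jet p φ)) :
    γ (familyObs ν (isSymFamily_one hf : IsSymFamily a b f)) =
      ∑ p, ∑ q, iteratedFunctional (Λ p) (M q) (mixedJet a b hf p q) := by
  rw [hγ]
  refine Finset.sum_congr rfl fun p _ => ?_
  have hjet : jet (p : TopologicalSpace.Compacts (Fin 1 → Phase d) × ℕ)
      (familyObs ν (isSymFamily_one hf : IsSymFamily a b f)) =
      ∑ q : t, (⟨M q, (M q).continuous⟩ : C(C(JetSpace d 1 q, ℝ), ℝ)).comp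
        (mixedJet a b hf p q).curry := by
    ext r
    have h1 := congrFun (dirDeriv_family ν (isSymFamily_one hf : IsSymFamily a b f)
      fun l => (r.2 l : Fin 1 → Phase d)) r.1
    refine h1.trans ?_
    rw [hν, ContinuousMap.sum_apply]
    refine Finset.sum_congr rfl fun q _ => ?_
    exact congrArg (M q) (jet_slice_dirDeriv (a := a) (b := b) hf p.1 q.1 r)
  rw [hjet, map_sum]
  rfl

/-- Fubini's theorem for one-particle states. -/
theorem apply_familyObs_comm (γ ν : State d 1) (hf : ContDiff ℝ ∞ f) :
    γ (familyObs ν (isSymFamily_one hf : IsSymFamily a b f)) =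
      ν (familyObs γ (isSymFamily_one hf : IsSymFamily b a f)) := by
  obtain ⟨s, Λ, hγ⟩ := γ.exists_eq_sum_jet
  obtain ⟨t, M, hν⟩ := ν.exists_eq_sum_jet
  rw [apply_familyObs_eq_sum hf hγ hν, apply_familyObs_eq_sum hf hν hγ, Finset.sum_comm]
  refine Finset.sum_congr rfl fun q _ => Finset.sum_congr rfl fun p _ => ?_
  rw [iteratedFunctional_comm, mixedJet_swap]

end Fubini

/-! ### Calculus of Gâteaux smooth maps -/

section Gateaux

universe u

variable {X : Type u} {Y Z V : Type*} [AddCommGroup X] [Module ℝ X]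
  [AddCommGroup Y] [Module ℝ Y] [TopologicalSpace Y]
  [AddCommGroup Z] [Module ℝ Z] [TopologicalSpace Z]
  [AddCommGroup V] [Module ℝ V] [TopologicalSpace V]

theorem HasGateauxDeriv.unique [T2Space Y] {f : X → Y} {x v : X} {y y' : Y}
    (h : HasGateauxDeriv f x v y) (h' : HasGateauxDeriv f x v y') : y = y' :=
  tendsto_nhds_unique h h'

theorem hasGateauxDeriv_const (c : Y) (x v : X) : HasGateauxDeriv (fun _ => c) x v 0 := by
  simpa [HasGateauxDeriv] using tendsto_const_nhds

theorem HasGateauxDeriv.add [IsTopologicalAddGroup Y] {f g : X → Y} {x v : X} {y y' : Y}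
    (hf : HasGateauxDeriv f x v y) (hg : HasGateauxDeriv g x v y') :
    HasGateauxDeriv (fun x => f x + g x) x v (y + y') := by
  refine (Filter.Tendsto.add hf hg).congr fun h => ?_
  rw [← smul_add, add_sub_add_comm]

theorem HasGateauxDeriv.clm_comp (L : Y →L[ℝ] Z) {f : X → Y} {x v : X} {y : Y}
    (hf : HasGateauxDeriv f x v y) : HasGateauxDeriv (fun x => L (f x)) x v (L y) := by
  refine ((L.continuous.tendsto y).comp hf).congr fun h => ?_
  simp

theorem hasGateauxDeriv_clm [TopologicalSpace X] (L : X →L[ℝ] Y) (x v : X) :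
    HasGateauxDeriv L x v (L v) := by
  refine tendsto_const_nhds.congr' ?_
  filter_upwards [self_mem_nhdsWithin] with h hh
  rw [map_add, add_sub_cancel_left, map_smul, smul_smul, inv_mul_cancel₀ hh, one_smul]

/-- A Gâteaux differentiable map is continuous along lines. -/
theorem HasGateauxDeriv.tendsto [IsTopologicalAddGroup Y] [ContinuousSMul ℝ Y] {f : X → Y}
    {x v : X} {y : Y} (hf : HasGateauxDeriv f x v y) :
    Filter.Tendsto (fun h : ℝ => f (x + h • v)) (𝓝[≠] 0) (𝓝 (f x)) := by
  have h0 : Filter.Tendsto (fun h : ℝ => h) (𝓝[≠] 0) (𝓝 0) :=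
    Filter.tendsto_id.mono_left nhdsWithin_le_nhds
  have h1 : Filter.Tendsto (fun h : ℝ => h • (h⁻¹ • (f (x + h • v) - f x)) + f x) (𝓝[≠] 0)
      (𝓝 ((0 : ℝ) • y + f x)) := (h0.smul hf).add tendsto_const_nhds
  rw [zero_smul, zero_add] at h1
  refine h1.congr' ?_
  filter_upwards [self_mem_nhdsWithin] with h hh
  rw [smul_smul, mul_inv_cancel₀ hh, one_smul, sub_add_cancel]

theorem HasGateauxDeriv.bilin [IsTopologicalAddGroup Z] [ContinuousSMul ℝ Z]
    [IsTopologicalAddGroup V] (B : Y →ₗ[ℝ] Z →ₗ[ℝ] V)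
    (hB : Continuous fun p : Y × Z => B p.1 p.2) {f : X → Y} {g : X → Z} {x v : X} {y : Y} {z : Z}
    (hf : HasGateauxDeriv f x v y) (hg : HasGateauxDeriv g x v z) :
    HasGateauxDeriv (fun x => B (f x) (g x)) x v (B y (g x) + B (f x) z) := by
  have h1 := (hB.tendsto (y, g x)).comp (hf.prodMk_nhds hg.tendsto)
  have h2 := (hB.tendsto (f x, z)).comp
    ((tendsto_const_nhds (x := f x) (f := 𝓝[≠] (0 : ℝ))).prodMk_nhds hg)
  refine (h1.add h2).congr fun h => ?_
  simp only [Function.comp_apply, map_smul, map_sub, LinearMap.smul_apply, LinearMap.sub_apply]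
  rw [← smul_add]
  congr 1
  abel

open Classical in
/-- The Gâteaux derivative of `f` at `x` in the direction `v` (and `0` if there is none). -/
noncomputable def gateauxDeriv (f : X → Y) (x v : X) : Y :=
  if h : ∃ y, HasGateauxDeriv f x v y then h.choose else 0

theorem HasGateauxDeriv.gateauxDeriv_eq [T2Space Y] {f : X → Y} {x v : X} {y : Y}
    (h : HasGateauxDeriv f x v y) : gateauxDeriv f x v = y := by
  have hex : ∃ y, HasGateauxDeriv f x v y := ⟨y, h⟩
  rw [gateauxDeriv, dif_pos hex]
  exact hex.choose_spec.unique h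

variable [TopologicalSpace X]

/-- `f (x, m)`, a map depending on a parameter `m`, is `n` times differentiable in `x` in the
Gâteaux sense, and the derivatives are jointly continuous in the point, the parameter and the
directions. A derivative is again such a map, with the direction added to the parameter. -/
def GateauxContDiff : (n : ℕ) → {M : Type u} → [TopologicalSpace M] → (X × M → Y) → Prop
  | 0, _, _, f => Continuous f
  | n + 1, M, _, f => Continuous f ∧ ∃ f' : X × (M × X) → Y,
      (∀ x m w, HasGateauxDeriv (fun y => f (y, m)) x w (f' (x, (m, w)))) ∧ GateauxContDiff n f'

variable {M N : Type u} [TopologicalSpace M] [TopologicalSpace N]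

theorem GateauxContDiff.continuous {n : ℕ} {f : X × M → Y} (hf : GateauxContDiff n f) :
    Continuous f := by
  cases n with
  | zero => exact hf
  | succ n => exact hf.1

theorem GateauxContDiff.of_succ {n : ℕ} {f : X × M → Y} (hf : GateauxContDiff (n + 1) f) :
    GateauxContDiff n f := by
  induction n generalizing M with
  | zero => exact hf.1
  | succ n ih =>
    obtain ⟨hc, f', hf', h⟩ := hf
    exact ⟨hc, f', hf', ih h⟩

theorem GateauxContDiff.reparam {n : ℕ} {f : X × M → Y} (hf : GateauxContDiff n f) {e : N → M}
    (he : Continuous e) : GateauxContDiff n fun p : X × N => f (p.1, e p.2) := by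
  induction n generalizing M N with
  | zero => exact hf.continuous.comp (by fun_prop)
  | succ n ih =>
    obtain ⟨hc, f', hf', h⟩ := hf
    have he' : Continuous fun q : N × X => (e q.1, q.2) := by fun_prop
    have hpe : Continuous fun p : X × N => (p.1, e p.2) := by fun_prop
    refine ⟨hc.comp hpe, fun p => f' (p.1, (e p.2.1, p.2.2)), fun x m w => ?_, ih h he'⟩
    exact hf' x (e m) w

theorem gateauxContDiff_param {n : ℕ} {g : M → Y} (hg : Continuous g) :
    GateauxContDiff n fun p : X × M => g p.2 := by
  induction n generalizing M g with
  | zero => exact hg.comp continuous_snd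
  | succ n ih =>
    have h0 : GateauxContDiff n fun _ : X × (M × X) => (0 : Y) :=
      ih (M := M × X) (g := fun _ => 0) continuous_const
    refine ⟨hg.comp continuous_snd, fun _ => 0, fun x m w => ?_, h0⟩
    exact hasGateauxDeriv_const (g m) x w

theorem gateauxContDiff_clm {n : ℕ} (L : X →L[ℝ] Y) :
    GateauxContDiff n fun p : X × M => L p.1 := by
  cases n with
  | zero => exact L.continuous.comp continuous_fst
  | succ n =>
    exact ⟨L.continuous.comp continuous_fst, fun p => L p.2.2,
      fun x m w => hasGateauxDeriv_clm L x w,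
      gateauxContDiff_param (g := fun q : M × X => L q.2) (by fun_prop)⟩

theorem GateauxContDiff.add [IsTopologicalAddGroup Y] {n : ℕ} {f g : X × M → Y}
    (hf : GateauxContDiff n f) (hg : GateauxContDiff n g) :
    GateauxContDiff n fun p => f p + g p := by
  induction n generalizing M with
  | zero => exact hf.continuous.add hg.continuous
  | succ n ih =>
    obtain ⟨hc, f', hf', h⟩ := hf
    obtain ⟨hc₂, g', hg', h₂⟩ := hg
    exact ⟨hc.add hc₂, fun p => f' p + g' p, fun x m w => (hf' x m w).add (hg' x m w), ih h h₂⟩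

theorem GateauxContDiff.clm_comp {n : ℕ} (L : Y →L[ℝ] Z) {f : X × M → Y}
    (hf : GateauxContDiff n f) : GateauxContDiff n fun p => L (f p) := by
  induction n generalizing M with
  | zero => exact L.continuous.comp hf.continuous
  | succ n ih =>
    obtain ⟨hc, f', hf', h⟩ := hf
    exact ⟨L.continuous.comp hc, fun p => L (f' p), fun x m w => (hf' x m w).clm_comp L, ih h⟩

/-- The Leibniz rule. -/
theorem GateauxContDiff.bilin [IsTopologicalAddGroup Z] [ContinuousSMul ℝ Z]
    [IsTopologicalAddGroup V] (B : Y →ₗ[ℝ] Z →ₗ[ℝ] V)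
    (hB : Continuous fun p : Y × Z => B p.1 p.2) {n : ℕ} {f : X × M → Y} {g : X × M → Z}
    (hf : GateauxContDiff n f) (hg : GateauxContDiff n g) :
    GateauxContDiff n fun p => B (f p) (g p) := by
  induction n generalizing M with
  | zero => exact hB.comp (hf.continuous.prodMk hg.continuous)
  | succ n ih =>
    have hf₀ := hf.of_succ
    have hg₀ := hg.of_succ
    obtain ⟨hc, f', hf', h⟩ := hf
    obtain ⟨hc₂, g', hg', h₂⟩ := hg
    have hfst : Continuous fun q : M × X => q.1 := continuous_fst
    exact ⟨hB.comp (hc.prodMk hc₂),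
      fun p => B (f' p) (g (p.1, p.2.1)) + B (f (p.1, p.2.1)) (g' p),
      fun x m w => (hf' x m w).bilin B hB (hg' x m w),
      (ih h (hg₀.reparam hfst)).add (ih (hf₀.reparam hfst) h₂)⟩

/-- The iterated Gâteaux derivatives of `f`. -/
noncomputable def iteratedGateauxDeriv (f : X → Y) : (n : ℕ) → X → (Fin n → X) → Y
  | 0, x, _ => f x
  | n + 1, x, v =>
    gateauxDeriv (fun y => iteratedGateauxDeriv f n y (Fin.init v)) x (v (Fin.last n))

/-- The iterated derivatives are determined by uniqueness of limits, so they inherit regularity from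
any family of derivatives as in `GateauxContDiff`. -/
theorem gateauxContDiff_iteratedGateauxDeriv [T2Space Y] {f : X → Y}
    (hf : ∀ n, GateauxContDiff n fun p : X × PUnit.{u + 1} => f p.1) (n k : ℕ) :
    GateauxContDiff k fun p : X × (Fin n → X) => iteratedGateauxDeriv f n p.1 p.2 := by
  induction n generalizing k with
  | zero => exact (hf k).reparam (e := fun _ : Fin 0 → X => PUnit.unit) continuous_const
  | succ n ih =>
    obtain ⟨-, f', hf', h⟩ := ih (k + 1)
    have e : (fun p : X × (Fin (n + 1) → X) => iteratedGateauxDeriv f (n + 1) p.1 p.2) =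
        fun p => f' (p.1, (Fin.init p.2, p.2 (Fin.last n))) := by
      funext p
      exact (hf' p.1 (Fin.init p.2) (p.2 (Fin.last n))).gateauxDeriv_eq
    rw [e]
    refine h.reparam (e := fun v : Fin (n + 1) → X => (Fin.init v, v (Fin.last n))) ?_
    unfold Fin.init
    fun_prop

theorem gateauxSmooth_of_forall_gateauxContDiff [T2Space Y] {f : X → Y}
    (hf : ∀ n, GateauxContDiff n fun p : X × PUnit.{u + 1} => f p.1) : GateauxSmooth f := by
  refine ⟨iteratedGateauxDeriv f, fun _ _ => rfl, fun n x v w => ?_,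
    fun n => (gateauxContDiff_iteratedGateauxDeriv hf n 0).continuous⟩
  obtain ⟨-, f', hf', -⟩ := gateauxContDiff_iteratedGateauxDeriv hf n 1
  have h := hf' x v w
  convert! h using 1
  rw [iteratedGateauxDeriv, Fin.init_snoc, Fin.snoc_last]
  exact h.gateauxDeriv_eq

theorem gateauxSmooth_pi {ι : Type*} {E : ι → Type*} [∀ i, AddCommGroup (E i)]
    [∀ i, Module ℝ (E i)] [∀ i, TopologicalSpace (E i)] {f : X → ∀ i, E i}
    (hf : ∀ i, GateauxSmooth fun x => f x i) : GateauxSmooth f := by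
  choose D h0 h1 h2 using hf
  exact ⟨fun n x v i => D i n x v, fun x v => funext fun i => h0 i x v,
    fun n x v w => tendsto_pi_nhds.2 fun i => h1 i n x v w,
    fun n => continuous_pi fun i => h2 i n⟩

end Gateaux

/-! ### Tensor powers and their derivatives -/

section TensorPower

variable {d k : ℕ}

/-- The state `f ↦ f z`. -/
noncomputable def evalState (z : Fin k → Phase d) : State d k :=
  ⟨{ toFun := fun f => f z, map_add' := fun _ _ => rfl, map_smul' := fun _ _ => rfl },
    WithSeminorms.continuous_real_rng (Obs.withSeminorms d k) _
      ⟨{(⟨{z}, isCompact_singleton⟩, 0)}, 1, fun f => by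
        have h := Obs.norm_iteratedFDeriv_le_seminorms (⟨{z}, isCompact_singleton⟩, 0) f
          (z := z) rfl
        rw [norm_iteratedFDeriv_zero] at h
        rw [one_smul, Finset.sup_singleton]
        exact (le_abs_self _).trans h⟩⟩

/-- The evaluation `ν ↦ ν f` of states on an observable. -/
noncomputable def evalObs (f : Obs d k) : State d k →L[ℝ] ℝ :=
  ⟨{ toFun := fun ν => ν f, map_add' := fun _ _ => rfl, map_smul' := fun _ _ => rfl },
    continuous_eval_const f⟩

theorem evalObs_apply (f : Obs d k) (ν : State d k) : evalObs f ν = ν f := rfl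

/-- The tensor power `γ^{⊗k}`, by recursion on `k`. -/
noncomputable def statePow (γ : State d 1) : (k : ℕ) → State d k
  | 0 => evalState Fin.elim0
  | k + 1 => tensor γ (statePow γ k)

theorem pairOne_eq_apply (γ : State d 1) (ψ : Obs d 1) :
    pairOne γ (fun z => ψ fun _ => z) = γ ψ := by
  have h : ContDiff ℝ ∞ fun z : Phase d => ψ fun _ => z :=
    ψ.contDiff.comp (contDiff_pi.2 fun _ => contDiff_id)
  rw [pairOne, dif_pos h]
  refine congrArg γ (Obs.ext fun z => ?_)
  have e : (fun _ => z 0) = z := funext fun i => by rw [Subsingleton.elim i 0]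
  exact congrArg ψ e

/-- The tensor power as a continuous functional has the values of the iterated pairing. -/
theorem statePow_apply (γ : State d 1) (f : Obs d k) :
    statePow γ k f = iteratedPairing γ k f := by
  induction k with
  | zero => rfl
  | succ k ih =>
    rw [statePow, tensor_apply, iteratedPairing, ← pairOne_eq_apply]
    congr 1
    funext z
    rw [partialPairing_apply, ih]
    congr 1
    funext w
    rw [slice_apply, firstIn_add_restIn]

theorem tensorPower_eq_statePow (γ : State d 1) (k : ℕ) : tensorPower γ k = statePow γ k := by
  have h : ∃ T : State d k, ∀ f : Obs d k, T f = iteratedPairing γ k f :=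
    ⟨statePow γ k, statePow_apply γ⟩
  rw [tensorPower, dif_pos h]
  ext f
  rw [h.choose_spec, statePow_apply]

theorem factorization_apply (γ : State d 1) (n : ℕ) :
    factorization d γ n = statePow γ (n + 1) := tensorPower_eq_statePow γ (n + 1)

theorem gateauxContDiff_statePow {M : Type} [TopologicalSpace M] (n k : ℕ) :
    GateauxContDiff n fun p : State d 1 × M => statePow p.1 k := by
  induction k with
  | zero => exact gateauxContDiff_param (g := fun _ : M => evalState Fin.elim0) continuous_const
  | succ k ih =>
    exact GateauxContDiff.bilin (tensorBilin d k) (continuous_tensorBilin d k)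
      (gateauxContDiff_clm (ContinuousLinearMap.id ℝ (State d 1))) ih

theorem gateauxSmooth_factorization (d : ℕ) : GateauxSmooth (factorization d) := by
  refine gateauxSmooth_pi fun n => ?_
  simp only [factorization_apply]
  exact gateauxSmooth_of_forall_gateauxContDiff fun m => gateauxContDiff_statePow m (n + 1)

/-- The configurations with first particle `x`, second particle `y` and zero elsewhere. -/
noncomputable def firstTwoIn (d k : ℕ) :
    (Fin 1 → Phase d) × (Fin 1 → Phase d) →L[ℝ] (Fin (k + 2) → Phase d) :=
  (firstIn d (k + 1)).coprod ((restIn d (k + 1)).comp (firstIn d k))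

theorem firstTwoIn_add (x y : Fin 1 → Phase d) (w : Fin k → Phase d) :
    firstTwoIn d k (x, y) + restIn d (k + 1) (restIn d k w) =
      Fin.cons (x 0) (Fin.cons (y 0) w) := by
  rw [← firstIn_add_restIn x, ← firstIn_add_restIn y w, map_add, ← add_assoc]
  simp [firstTwoIn]

theorem Obs.isSymFamily_firstTwo (f : Obs d (k + 2)) :
    IsSymFamily (firstTwoIn d k) ((restIn d (k + 1)).comp (restIn d k))
      (f : (Fin (k + 2) → Phase d) → ℝ) where
  smooth := f.contDiff
  symm := by
    rintro ⟨x, y⟩ π w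
    have h := (tailObs f x).isSymFamily_head.symm y π w
    simp only [slice_apply, firstIn_add_restIn] at h
    simpa only [ContinuousLinearMap.comp_apply, firstTwoIn_add] using h

theorem tailObs_tailObs_apply (f : Obs d (k + 2)) (x y : Fin 1 → Phase d) (w : Fin k → Phase d) :
    tailObs (tailObs f x) y w = f (Fin.cons (x 0) (Fin.cons (y 0) w)) := by
  rw [slice_apply, slice_apply, firstIn_add_restIn, firstIn_add_restIn]

theorem slice_firstTwo (f : Obs d (k + 2)) (x y : Fin 1 → Phase d) :
    slice f.isSymFamily_firstTwo (x, y) = tailObs (tailObs f x) y :=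
  Obs.ext fun w => by
    rw [tailObs_tailObs_apply, slice_apply, ContinuousLinearMap.comp_apply, firstTwoIn_add]

theorem cons_cons_comp_swap (x y : Phase d) (w : Fin k → Phase d) :
    (Fin.cons x (Fin.cons y w) : Fin (k + 2) → Phase d) ∘ Equiv.swap 0 1 =
      Fin.cons y (Fin.cons x w) := by
  funext i
  refine Fin.cases ?_ (fun j => Fin.cases ?_ (fun l => ?_) j) i
  · simp
  · simp
  · have h : Equiv.swap (0 : Fin (k + 2)) 1 l.succ.succ = l.succ.succ :=
      Equiv.swap_apply_of_ne_of_ne (Fin.succ_ne_zero _)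
        (fun h => Fin.succ_ne_zero l (Fin.succ_injective _ h))
    simp [h]

theorem tailObs_tailObs_comm (f : Obs d (k + 2)) (x y : Fin 1 → Phase d) :
    tailObs (tailObs f x) y = tailObs (tailObs f y) x :=
  Obs.ext fun w => by
    rw [tailObs_tailObs_apply, tailObs_tailObs_apply, ← f.symm (Equiv.swap 0 1),
      cons_cons_comp_swap]

/-- Since observables are symmetric, Fubini's theorem allows to exchange the first two factors. -/
theorem tensor_left_comm (γ ν : State d 1) (τ : State d k) :
    tensor γ (tensor ν τ) = tensor ν (tensor γ τ) := by
  ext f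
  have hs : ContDiff ℝ ∞ fun q : (Fin 1 → Phase d) × (Fin 1 → Phase d) =>
      τ (slice f.isSymFamily_firstTwo q) := contDiff_family τ _
  have h := apply_familyObs_comm (a := .inl ℝ _ _) (b := .inr ℝ _ _) γ ν hs
  have key : ∀ γ ν : State d 1, tensor γ (tensor ν τ) f =
      γ (familyObs ν (isSymFamily_one hs : IsSymFamily (.inl ℝ _ _) (.inr ℝ _ _) _)) := by
    intro γ ν
    refine congrArg γ (Obs.ext fun x => congrArg ν (Obs.ext fun y => ?_))
    have e : (ContinuousLinearMap.inl ℝ (Fin 1 → Phase d) (Fin 1 → Phase d)) x +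
        (ContinuousLinearMap.inr ℝ (Fin 1 → Phase d) (Fin 1 → Phase d)) y = (x, y) := by simp
    rw [slice_apply, e, slice_firstTwo]
    rfl
  rw [key γ ν, key ν γ, h]
  refine congrArg ν (Obs.ext fun y => congrArg γ (Obs.ext fun x => ?_))
  have e : (ContinuousLinearMap.inl ℝ (Fin 1 → Phase d) (Fin 1 → Phase d)) y +
      (ContinuousLinearMap.inr ℝ (Fin 1 → Phase d) (Fin 1 → Phase d)) x = (y, x) := by simp
  have e' : (ContinuousLinearMap.inr ℝ (Fin 1 → Phase d) (Fin 1 → Phase d)) y +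
      (ContinuousLinearMap.inl ℝ (Fin 1 → Phase d) (Fin 1 → Phase d)) x = (x, y) := by simp
  rw [slice_apply, slice_apply, e, e', slice_firstTwo, slice_firstTwo, tailObs_tailObs_comm]

/-- The `k + 1` terms of the Leibniz rule agree, because the differentiated factor can be moved to
the front. -/
theorem hasGateauxDeriv_statePow (γ ν : State d 1) (k : ℕ) :
    HasGateauxDeriv (fun γ => statePow γ (k + 1)) γ ν
      (((k + 1 : ℕ) : ℝ) • tensor ν (statePow γ k)) := by
  have hid : HasGateauxDeriv (fun γ : State d 1 => γ) γ ν ν :=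
    hasGateauxDeriv_clm (ContinuousLinearMap.id ℝ (State d 1)) γ ν
  induction k with
  | zero =>
    have h := hid.bilin (tensorBilin d 0) (continuous_tensorBilin d 0)
      (hasGateauxDeriv_const (statePow γ 0) γ ν)
    rw [map_zero, add_zero] at h
    convert! h using 1
    rw [tensorBilin_apply, Nat.cast_one, one_smul]
  | succ k ih =>
    have h := hid.bilin (tensorBilin d (k + 1)) (continuous_tensorBilin d (k + 1)) ih
    convert! h using 1
    rw [map_smul, tensorBilin_apply, tensorBilin_apply, tensor_left_comm]
    push_cast
    rw [add_smul, one_smul]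
    exact add_comm _ _

end TensorPower

/-! ### The duality pairing and uniqueness of gradients -/

section Pairing

variable {d : ℕ}

theorem pairing_add (F G : ObsHierarchy d) (Γ : StateHierarchy d) :
    pairing (F + G) Γ = pairing F Γ + pairing G Γ := map_add _ F G

theorem pairing_smul (c : ℝ) (F : ObsHierarchy d) (Γ : StateHierarchy d) :
    pairing (c • F) Γ = c * pairing F Γ := map_smul _ c F

theorem pairing_zero (Γ : StateHierarchy d) : pairing (0 : ObsHierarchy d) Γ = 0 := map_zero _

theorem pairing_of (n : ℕ) (f : Obs d (n + 1)) (Γ : StateHierarchy d) :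
    pairing (DirectSum.of (fun n => Obs d (n + 1)) n f) Γ = Γ n f :=
  DirectSum.toModule_lof (M := fun n => Obs d (n + 1)) ℝ n f

theorem exists_clm_eq_pairing (F : ObsHierarchy d) :
    ∃ L : StateHierarchy d →L[ℝ] ℝ, ∀ Γ, L Γ = pairing F Γ := by
  induction F using DirectSum.induction_on with
  | zero => exact ⟨0, fun Γ => (pairing_zero Γ).symm⟩
  | of n f =>
    exact ⟨(evalObs f).comp (ContinuousLinearMap.proj n), fun Γ => (pairing_of n f Γ).symm⟩
  | add F G hF hG =>
    obtain ⟨L, hL⟩ := hF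
    obtain ⟨L', hL'⟩ := hG
    exact ⟨L + L', fun Γ => by rw [pairing_add, ← hL, ← hL']; rfl⟩

/-- Hierarchies of states with a single nonzero entry detect the entries of `F`. -/
theorem pairing_single (F : ObsHierarchy d) (n : ℕ) (ν : State d (n + 1)) :
    pairing F (Pi.single n ν) = ν (F n) := by
  induction F using DirectSum.induction_on with
  | zero => rw [pairing_zero, DirectSum.zero_apply, map_zero]
  | of m f =>
    rw [pairing_of]
    by_cases h : m = n
    · subst h
      rw [Pi.single_eq_same, DirectSum.of_eq_same]
    · rw [Pi.single_eq_of_ne h, DirectSum.of_eq_of_ne _ _ _ (Ne.symm h), map_zero]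
      rfl
  | add F G hF hG => rw [pairing_add, DirectSum.add_apply, map_add, hF, hG]

theorem IsHierarchyGradient.unique {𝓕 : StateHierarchy d → ℝ} {Γ : StateHierarchy d}
    {F G : ObsHierarchy d} (hF : IsHierarchyGradient 𝓕 Γ F) (hG : IsHierarchyGradient 𝓕 Γ G) :
    F = G := by
  refine DFinsupp.ext fun n => Obs.ext fun z => ?_
  have h := (hF (Pi.single n (evalState z))).unique (hG (Pi.single n (evalState z)))
  rwa [pairing_single, pairing_single] at h

theorem IsGradient.unique {k : ℕ} {𝓕 : State d k → ℝ} {γ : State d k} {f g : Obs d k}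
    (hf : IsGradient 𝓕 γ f) (hg : IsGradient 𝓕 γ g) : f = g :=
  Obs.ext fun z => (hf (evalState z)).unique (hg (evalState z))

theorem IsHierarchyGradient.hierarchyGradient_eq {𝓕 : StateHierarchy d → ℝ}
    {Γ : StateHierarchy d} {F : ObsHierarchy d} (hF : IsHierarchyGradient 𝓕 Γ F) :
    hierarchyGradient 𝓕 Γ = F := by
  have h : ∃ F, IsHierarchyGradient 𝓕 Γ F := ⟨F, hF⟩
  rw [hierarchyGradient, dif_pos h]
  exact h.choose_spec.unique hF

theorem IsGradient.gradient_eq {k : ℕ} {𝓕 : State d k → ℝ} {γ : State d k} {f : Obs d k}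
    (hf : IsGradient 𝓕 γ f) : gradient 𝓕 γ = f := by
  have h : ∃ f, IsGradient 𝓕 γ f := ⟨f, hf⟩
  rw [gradient, dif_pos h]
  exact h.choose_spec.unique hf

end Pairing

/-! ### Gradients of admissible functionals -/

section Admissible

variable {d : ℕ}

/-- The transpose of the derivative of the factorization map at `γ`: on `𝔤_k` it is
`f ↦ k ⟨f (z, ·), γ^{⊗(k-1)}⟩`. -/
noncomputable def pullbackGradient (γ : State d 1) : ObsHierarchy d →ₗ[ℝ] Obs d 1 :=
  DirectSum.toModule ℝ ℕ (Obs d 1) fun n => ((n + 1 : ℕ) : ℝ) • partialPairing (statePow γ n)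

theorem pullbackGradient_of (γ : State d 1) (n : ℕ) (f : Obs d (n + 1)) :
    pullbackGradient γ (DirectSum.of (fun n => Obs d (n + 1)) n f) =
      ((n + 1 : ℕ) : ℝ) • partialPairing (statePow γ n) f :=
  DirectSum.toModule_lof (M := fun n => Obs d (n + 1)) ℝ n f

theorem isGradient_pairing_factorization (F : ObsHierarchy d) (γ : State d 1) :
    IsGradient (pairing F ∘ factorization d) γ (pullbackGradient γ F) := by
  intro ν
  induction F using DirectSum.induction_on with
  | zero =>
    have e : pairing (0 : ObsHierarchy d) ∘ factorization d = fun _ => 0 :=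
      funext fun γ => pairing_zero _
    rw [e, map_zero, map_zero]
    exact hasGateauxDeriv_const 0 γ ν
  | of n f =>
    have e : pairing (DirectSum.of (fun n => Obs d (n + 1)) n f) ∘ factorization d =
        fun γ => evalObs f (statePow γ (n + 1)) :=
      funext fun γ => by
        rw [Function.comp_apply, pairing_of, factorization_apply, evalObs_apply]
    rw [e, pullbackGradient_of, map_smul]
    exact (hasGateauxDeriv_statePow γ ν n).clm_comp (evalObs f)
  | add F G hF hG =>
    have e : pairing (F + G) ∘ factorization d = fun γ =>
        (pairing F ∘ factorization d) γ + (pairing G ∘ factorization d) γ :=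
      funext fun γ => pairing_add F G _
    rw [e, map_add, map_add]
    exact hF.add hG

theorem gateauxContDiff_pairing_factorization {M : Type} [TopologicalSpace M] (n : ℕ)
    (F : ObsHierarchy d) :
    GateauxContDiff n fun p : State d 1 × M => pairing F (factorization d p.1) := by
  induction F using DirectSum.induction_on with
  | zero =>
    simp only [pairing_zero]
    exact gateauxContDiff_param (g := fun _ : M => (0 : ℝ)) continuous_const
  | of m f =>
    simp only [pairing_of, factorization_apply]
    exact (gateauxContDiff_statePow n (m + 1)).clm_comp (evalObs f)
  | add F G hF hG =>
    simp only [pairing_add]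
    exact hF.add hG

theorem continuous_mul_linearMap : Continuous fun p : ℝ × ℝ => LinearMap.mul ℝ ℝ p.1 p.2 :=
  continuous_mul

theorem gateauxContDiff_admissible {M : Type} [TopologicalSpace M] {𝓕 : StateHierarchy d → ℝ}
    (h𝓕 : 𝓕 ∈ admissible d) (n : ℕ) : GateauxContDiff n fun p : StateHierarchy d × M => 𝓕 p.1 := by
  induction h𝓕 using Algebra.adjoin_induction with
  | mem 𝓕 h =>
    obtain ⟨F, rfl⟩ := h
    obtain ⟨L, hL⟩ := exists_clm_eq_pairing F
    simp only [← hL]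
    exact gateauxContDiff_clm L
  | algebraMap c => exact gateauxContDiff_param (g := fun _ : M => c) continuous_const
  | add 𝓕 𝓖 _ _ h h' => exact h.add h'
  | mul 𝓕 𝓖 _ _ h h' => exact h.bilin (LinearMap.mul ℝ ℝ) continuous_mul_linearMap h'

theorem gateauxContDiff_admissible_factorization {M : Type} [TopologicalSpace M]
    {𝓕 : StateHierarchy d → ℝ} (h𝓕 : 𝓕 ∈ admissible d) (n : ℕ) :
    GateauxContDiff n fun p : State d 1 × M => 𝓕 (factorization d p.1) := by
  induction h𝓕 using Algebra.adjoin_induction with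
  | mem 𝓕 h =>
    obtain ⟨F, rfl⟩ := h
    exact gateauxContDiff_pairing_factorization n F
  | algebraMap c => exact gateauxContDiff_param (g := fun _ : M => c) continuous_const
  | add 𝓕 𝓖 _ _ h h' => exact h.add h'
  | mul 𝓕 𝓖 _ _ h h' => exact h.bilin (LinearMap.mul ℝ ℝ) continuous_mul_linearMap h'

/-- Admissible functionals have gradients, and the gradient of the pullback along the
factorization map is given by the chain rule. -/
theorem exists_isHierarchyGradient {𝓕 : StateHierarchy d → ℝ} (h𝓕 : 𝓕 ∈ admissible d)
    (Γ : StateHierarchy d) :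
    ∃ F, IsHierarchyGradient 𝓕 Γ F ∧ ∀ γ, Γ = factorization d γ →
      IsGradient (𝓕 ∘ factorization d) γ (pullbackGradient γ F) := by
  induction h𝓕 using Algebra.adjoin_induction with
  | mem 𝓕 h =>
    obtain ⟨F, rfl⟩ := h
    refine ⟨F, fun Δ => ?_, fun γ _ => isGradient_pairing_factorization F γ⟩
    obtain ⟨L, hL⟩ := exists_clm_eq_pairing F
    have e : pairing F = L := funext fun Γ => (hL Γ).symm
    change HasGateauxDeriv (pairing F) Γ Δ _
    rw [e]
    exact hasGateauxDeriv_clm L Γ Δ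
  | algebraMap c =>
    refine ⟨0, fun Δ => ?_, fun γ _ ν => ?_⟩
    · rw [pairing_zero]
      exact hasGateauxDeriv_const c Γ Δ
    · rw [map_zero, map_zero]
      exact hasGateauxDeriv_const c γ ν
  | add 𝓕 𝓖 _ _ h h' =>
    obtain ⟨F, hF, hF'⟩ := h
    obtain ⟨G, hG, hG'⟩ := h'
    refine ⟨F + G, fun Δ => ?_, fun γ hγ ν => ?_⟩
    · rw [pairing_add]
      exact (hF Δ).add (hG Δ)
    · rw [map_add, map_add]
      exact (hF' γ hγ ν).add (hG' γ hγ ν)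
  | mul 𝓕 𝓖 _ _ h h' =>
    obtain ⟨F, hF, hF'⟩ := h
    obtain ⟨G, hG, hG'⟩ := h'
    refine ⟨𝓖 Γ • F + 𝓕 Γ • G, fun Δ => ?_, fun γ hγ ν => ?_⟩
    · rw [pairing_add, pairing_smul, pairing_smul, mul_comm (𝓖 Γ)]
      exact (hF Δ).bilin (LinearMap.mul ℝ ℝ) continuous_mul_linearMap (hG Δ)
    · rw [map_add, map_add, map_smul, map_smul, map_smul, map_smul, smul_eq_mul, smul_eq_mul,
        mul_comm (𝓖 Γ), hγ]
      exact (hF' γ hγ ν).bilin (LinearMap.mul ℝ ℝ) continuous_mul_linearMap (hG' γ hγ ν)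

end Admissible

/-! ### Iterated pairings of functions without symmetry -/

section IteratedPairing

variable {d : ℕ}

section PairOne

variable {P : Type*} [NormedAddCommGroup P] [NormedSpace ℝ P]

/-- Places a one-particle configuration in the second factor of `P × ℝ^{2d}`. -/
noncomputable def sndIn (P : Type*) [NormedAddCommGroup P] [NormedSpace ℝ P] (d : ℕ) :
    (Fin 1 → Phase d) →L[ℝ] P × Phase d :=
  (ContinuousLinearMap.inr ℝ P (Phase d)).comp (ContinuousLinearMap.proj 0)

theorem inl_add_sndIn (x : P) (z : Fin 1 → Phase d) :
    ContinuousLinearMap.inl ℝ P (Phase d) x + sndIn P d z = (x, z 0) := by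
  simp [sndIn]

theorem pairOne_eq_slice (γ : State d 1) {G : P × Phase d → ℝ} (hG : ContDiff ℝ ∞ G) (x : P) :
    pairOne γ (fun z => G (x, z)) =
      γ (slice (isSymFamily_one hG : IsSymFamily (.inl ℝ P (Phase d)) (sndIn P d) G) x) := by
  rw [← pairOne_eq_apply]
  congr 1
  funext z
  rw [slice_apply, inl_add_sndIn]

theorem contDiff_pairOne [FiniteDimensional ℝ P] (γ : State d 1) {G : P × Phase d → ℝ} (hG : ContDiff ℝ ∞ G) :
    ContDiff ℝ ∞ fun x => pairOne γ fun z => G (x, z) := by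
  simp only [pairOne_eq_slice γ hG]
  exact contDiff_family γ _

end PairOne

theorem pairOne_add (γ : State d 1) {φ ψ : Phase d → ℝ} (hφ : ContDiff ℝ ∞ φ)
    (hψ : ContDiff ℝ ∞ ψ) :
    pairOne γ (fun z => φ z + ψ z) = pairOne γ φ + pairOne γ ψ := by
  rw [pairOne, pairOne, pairOne, dif_pos hφ, dif_pos hψ, dif_pos (hφ.add hψ), ← map_add]
  rfl

theorem pairOne_const_mul (γ : State d 1) {φ : Phase d → ℝ} (hφ : ContDiff ℝ ∞ φ) (c : ℝ) :
    pairOne γ (fun z => c * φ z) = c * pairOne γ φ := by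
  rw [pairOne, pairOne, dif_pos hφ, dif_pos (contDiff_const.mul hφ), ← smul_eq_mul, ← map_smul]
  rfl

/-- Fubini's theorem for the pairing of smooth functions of two particles. -/
theorem pairOne_comm (γ ν : State d 1) {G : Phase d × Phase d → ℝ} (hG : ContDiff ℝ ∞ G) :
    pairOne γ (fun x => pairOne ν fun y => G (x, y)) =
      pairOne ν (fun y => pairOne γ fun x => G (x, y)) := by
  have h := apply_familyObs_comm (a := (ContinuousLinearMap.inl ℝ (Phase d) (Phase d)).comp
    (ContinuousLinearMap.proj 0)) (b := sndIn (Phase d) d) γ ν hG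
  rw [← pairOne_eq_apply, ← pairOne_eq_apply ν] at h
  have e1 : ∀ x : Phase d, ∀ z : Fin 1 → Phase d, (ContinuousLinearMap.inl ℝ (Phase d) (Phase d))
      ((ContinuousLinearMap.proj 0 : (Fin 1 → Phase d) →L[ℝ] Phase d) fun _ => x) +
        sndIn (Phase d) d z = (x, z 0) := fun x z => inl_add_sndIn x z
  refine Eq.trans (Eq.symm ?_) (h.trans ?_)
  · congr 1
    funext x
    refine (pairOne_eq_apply ν (slice _ _)).symm.trans ?_
    congr 1
    funext y
    rw [slice_apply, ContinuousLinearMap.comp_apply, e1]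
  · congr 1
    funext y
    refine (pairOne_eq_apply γ (slice _ _)).symm.trans ?_
    congr 1
    funext x
    rw [slice_apply, ContinuousLinearMap.comp_apply, add_comm, e1]

/-- The linear map `((x, z), w) ↦ (x, (z, w))` that moves a particle from the parameters to the
configuration. -/
noncomputable def shiftIn (P : Type*) [NormedAddCommGroup P] [NormedSpace ℝ P] (d k : ℕ) :
    (P × Phase d) × (Fin k → Phase d) →L[ℝ] P × (Fin (k + 1) → Phase d) :=
  ((ContinuousLinearMap.fst ℝ _ _).comp (ContinuousLinearMap.fst ℝ _ _)).prod
    (ContinuousLinearMap.pi fun i => Fin.cases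
      ((ContinuousLinearMap.snd ℝ P (Phase d)).comp (ContinuousLinearMap.fst ℝ _ _))
      (fun j => (ContinuousLinearMap.proj j).comp (ContinuousLinearMap.snd ℝ _ _)) i)

theorem shiftIn_apply {P : Type*} [NormedAddCommGroup P] [NormedSpace ℝ P] {k : ℕ} (x : P)
    (z : Phase d) (w : Fin k → Phase d) : shiftIn P d k ((x, z), w) = (x, Fin.cons z w) := by
  refine Prod.ext rfl (funext fun i => ?_)
  refine Fin.cases ?_ (fun j => ?_) i <;> simp [shiftIn]

theorem contDiff_iteratedPairing (γ : State d 1) {k : ℕ} {P : Type*} [NormedAddCommGroup P]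
    [NormedSpace ℝ P] [FiniteDimensional ℝ P] {F : P × (Fin k → Phase d) → ℝ}
    (hF : ContDiff ℝ ∞ F) : ContDiff ℝ ∞ fun x => iteratedPairing γ k fun w => F (x, w) := by
  induction k generalizing P with
  | zero => exact hF.comp (contDiff_id.prodMk contDiff_const)
  | succ k ih =>
    have h := contDiff_pairOne γ (ih (hF.comp (shiftIn P d k).contDiff))
    simp only [Function.comp_apply, shiftIn_apply] at h
    exact h

theorem contDiff_finCons (d k : ℕ) :
    ContDiff ℝ ∞ fun p : Phase d × (Fin k → Phase d) =>
      (Fin.cons p.1 p.2 : Fin (k + 1) → Phase d) := by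
  refine contDiff_pi.2 fun i => ?_
  refine Fin.cases ?_ (fun j => ?_) i
  · exact contDiff_fst
  · exact (contDiff_apply ℝ (Phase d) j).comp contDiff_snd

theorem contDiff_comp_finCons {k : ℕ} {f : (Fin (k + 1) → Phase d) → ℝ} (hf : ContDiff ℝ ∞ f)
    (z : Phase d) : ContDiff ℝ ∞ fun w : Fin k → Phase d => f (Fin.cons z w) :=
  (hf.comp (contDiff_finCons d k)).comp (contDiff_const.prodMk contDiff_id)

/-- The partial pairing `z ↦ ⟨f (z, ·), γ^{⊗k}⟩` of a smooth function is smooth. -/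
theorem contDiff_iteratedPairing_cons (γ : State d 1) {k : ℕ} {f : (Fin (k + 1) → Phase d) → ℝ}
    (hf : ContDiff ℝ ∞ f) :
    ContDiff ℝ ∞ fun z => iteratedPairing γ k fun w => f (Fin.cons z w) :=
  contDiff_iteratedPairing γ (F := fun p => f (Fin.cons p.1 p.2)) (hf.comp (contDiff_finCons d k))

theorem iteratedPairing_add (γ : State d 1) {k : ℕ} {f g : (Fin k → Phase d) → ℝ}
    (hf : ContDiff ℝ ∞ f) (hg : ContDiff ℝ ∞ g) :
    iteratedPairing γ k (fun w => f w + g w) = iteratedPairing γ k f + iteratedPairing γ k g := by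
  induction k with
  | zero => rfl
  | succ k ih =>
    simp only [iteratedPairing]
    rw [← pairOne_add γ (contDiff_iteratedPairing_cons γ hf) (contDiff_iteratedPairing_cons γ hg)]
    congr 1
    funext z
    exact ih (contDiff_comp_finCons hf z) (contDiff_comp_finCons hg z)

theorem iteratedPairing_const_mul (γ : State d 1) {k : ℕ} {f : (Fin k → Phase d) → ℝ}
    (hf : ContDiff ℝ ∞ f) (c : ℝ) :
    iteratedPairing γ k (fun w => c * f w) = c * iteratedPairing γ k f := by
  induction k with
  | zero => rfl
  | succ k ih =>
    simp only [iteratedPairing]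
    rw [← pairOne_const_mul γ (contDiff_iteratedPairing_cons γ hf)]
    congr 1
    funext z
    exact ih (contDiff_comp_finCons hf z)

theorem iteratedPairing_sum (γ : State d 1) {k : ℕ} {ι : Type*} (s : Finset ι)
    {f : ι → (Fin k → Phase d) → ℝ} (hf : ∀ i, ContDiff ℝ ∞ (f i)) :
    iteratedPairing γ k (fun w => ∑ i ∈ s, f i w) = ∑ i ∈ s, iteratedPairing γ k (f i) := by
  classical
  induction s using Finset.induction_on with
  | empty =>
    have h := iteratedPairing_const_mul γ (k := k) (f := fun _ => 0) contDiff_const 0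
    simpa using h
  | insert i s hi ih =>
    simp only [Finset.sum_insert hi]
    rw [iteratedPairing_add γ (hf i) (ContDiff.sum fun j _ => hf j), ih]

/-- By Fubini's theorem, an exchange of two neighbouring particles does not change the iterated
pairing. -/
theorem iteratedPairing_comp_swap (γ : State d 1) {n : ℕ} {f : (Fin (n + 1) → Phase d) → ℝ}
    (hf : ContDiff ℝ ∞ f) (i : Fin n) :
    iteratedPairing γ (n + 1) (fun w => f (w ∘ Equiv.swap i.castSucc i.succ)) =
      iteratedPairing γ (n + 1) f := by
  induction n with
  | zero => exact i.elim0
  | succ n ih =>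
    refine Fin.cases ?_ (fun j => ?_) i
    · have hG : ContDiff ℝ ∞ fun q : Phase d × Phase d =>
          iteratedPairing γ n fun w => f (Fin.cons q.1 (Fin.cons q.2 w)) := by
        refine contDiff_iteratedPairing γ
          (F := fun p : (Phase d × Phase d) × (Fin n → Phase d) =>
            f (Fin.cons p.1.1 (Fin.cons p.1.2 p.2))) ?_
        exact hf.comp ((contDiff_finCons d (n + 1)).comp (contDiff_fst.fst.prodMk
          ((contDiff_finCons d n).comp (contDiff_fst.snd.prodMk contDiff_snd))))
      have h := pairOne_comm γ γ hG
      simp only [iteratedPairing, Fin.castSucc_zero, Fin.succ_zero_eq_one, cons_cons_comp_swap]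
      exact h.symm
    · rw [iteratedPairing, iteratedPairing]
      congr 1
      funext z
      rw [← ih (contDiff_comp_finCons hf z) j]
      congr 1
      funext w
      congr 1
      funext l
      rw [← Fin.succ_castSucc]
      refine Fin.cases ?_ (fun m => ?_) l
      · have h : Equiv.swap j.castSucc.succ j.succ.succ 0 = 0 :=
          Equiv.swap_apply_of_ne_of_ne (Fin.succ_ne_zero _).symm (Fin.succ_ne_zero _).symm
        simp [h]
      · have h : Equiv.swap j.castSucc.succ j.succ.succ m.succ =
            (Equiv.swap j.castSucc j.succ m).succ := (Fin.succ_injective _).swap_apply _ _ _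
        simp [h]

theorem contDiff_comp_perm {k : ℕ} {f : (Fin k → Phase d) → ℝ} (hf : ContDiff ℝ ∞ f)
    (π : Equiv.Perm (Fin k)) : ContDiff ℝ ∞ fun w : Fin k → Phase d => f (w ∘ π) :=
  hf.comp (contDiff_pi.2 fun i => contDiff_apply ℝ (Phase d) (π i))

theorem iteratedPairing_comp_perm (γ : State d 1) {n : ℕ} {f : (Fin (n + 1) → Phase d) → ℝ}
    (hf : ContDiff ℝ ∞ f) (π : Equiv.Perm (Fin (n + 1))) :
    iteratedPairing γ (n + 1) (fun w => f (w ∘ π)) = iteratedPairing γ (n + 1) f := by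
  have hπ : π ∈ Submonoid.closure
      (Set.range fun i : Fin n => Equiv.swap i.castSucc i.succ) := by
    rw [Equiv.Perm.mclosure_swap_castSucc_succ]
    trivial
  induction hπ using Submonoid.closure_induction generalizing f with
  | mem π h =>
    obtain ⟨i, rfl⟩ := h
    exact iteratedPairing_comp_swap γ hf i
  | one => rfl
  | mul π σ _ _ h h' =>
    exact (h (contDiff_comp_perm hf σ)).trans (h' hf)

/-- The iterated pairing ignores symmetrization. -/
theorem statePow_sym (γ : State d 1) {n : ℕ} {h : (Fin (n + 1) → Phase d) → ℝ}
    (hh : ContDiff ℝ ∞ h) : statePow γ (n + 1) (sym h hh) = iteratedPairing γ (n + 1) h := by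
  rw [statePow_apply]
  change iteratedPairing γ (n + 1) (fun z => (((n + 1).factorial : ℝ))⁻¹ *
    ∑ π : Equiv.Perm (Fin (n + 1)), h (z ∘ π)) = _
  rw [iteratedPairing_const_mul γ (ContDiff.sum fun π _ => contDiff_comp_perm hh π),
    iteratedPairing_sum γ _ (fun π => contDiff_comp_perm hh π)]
  simp only [iteratedPairing_comp_perm γ hh]
  rw [Finset.sum_const, Finset.card_univ, Fintype.card_perm, Fintype.card_fin, nsmul_eq_mul,
    inv_mul_cancel_left₀ (by positivity)]

/-- The iterated pairing is multiplicative on products of functions of different particles. -/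
theorem iteratedPairing_mul (γ : State d 1) {a b n : ℕ} (h : a + b = n)
    {u : (Fin a → Phase d) → ℝ} {v : (Fin b → Phase d) → ℝ} (hu : ContDiff ℝ ∞ u)
    (hv : ContDiff ℝ ∞ v) :
    iteratedPairing γ n (fun w => u (fun i => w ⟨i, by omega⟩) * v (fun i => w ⟨a + i, by omega⟩)) =
      iteratedPairing γ a u * iteratedPairing γ b v := by
  induction a generalizing n with
  | zero =>
    obtain rfl : b = n := by omega
    rw [iteratedPairing, ← iteratedPairing_const_mul γ hv]
    congr 1
    funext w
    congr 2
    · funext i; exact i.elim0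
    · funext i
      congr 1
      exact Fin.ext (zero_add _)
  | succ a ih =>
    obtain ⟨m, rfl⟩ : ∃ m, n = m + 1 := ⟨n - 1, by omega⟩
    rw [iteratedPairing, iteratedPairing, mul_comm,
      ← pairOne_const_mul γ (contDiff_iteratedPairing_cons γ hu)]
    congr 1
    funext z
    rw [mul_comm, ← ih (n := m) (by omega) (contDiff_comp_finCons hu z)]
    congr 1
    funext w
    congr 2
    · funext i
      refine Fin.cases ?_ (fun j => ?_) i <;> rfl
    · funext i
      have e : (⟨a + 1 + i, by omega⟩ : Fin (m + 1)) = Fin.succ ⟨a + i, by omega⟩ :=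
        Fin.ext (by simp; omega)
      rw [e, Fin.cons_succ]

end IteratedPairing

/-! ### Compatibility of the Lie brackets -/

section Bracket

variable {d k : ℕ}

theorem fderiv_partialPairing (γ : State d 1) (f : Obs d (k + 1)) (z u : Phase d) :
    fderiv ℝ (partialPairing (statePow γ k) f) (fun _ => z) (Pi.single 0 u) =
      iteratedPairing γ k fun w => fderiv ℝ f (Fin.cons z w) (Pi.single 0 u) := by
  have h := fderiv_family_apply (statePow γ k) f.isSymFamily_head (fun _ => z) (Pi.single 0 u)
  refine h.trans ?_
  rw [statePow_apply]
  congr 1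
  funext w
  rw [slice_apply, firstIn_add_restIn, firstIn_eq_single]

theorem dx_partialPairing (γ : State d 1) (f : Obs d (k + 1)) (m : Fin d) (z : Phase d) :
    dx (partialPairing (statePow γ k) f) 0 m (fun _ => z) =
      iteratedPairing γ k fun w => dx f 0 m (Fin.cons z w) :=
  fderiv_partialPairing γ f z _

theorem dv_partialPairing (γ : State d 1) (f : Obs d (k + 1)) (m : Fin d) (z : Phase d) :
    dv (partialPairing (statePow γ k) f) 0 m (fun _ => z) =
      iteratedPairing γ k fun w => dv f 0 m (Fin.cons z w) :=
  fderiv_partialPairing γ f z _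

theorem headTuple_cons {a n : ℕ} (ha : a ≤ n) (z : Phase d) (w : Fin n → Phase d) :
    headTuple a ha (Fin.cons z w) = Fin.cons z fun i : Fin a => w ⟨i, by omega⟩ := by
  funext i
  refine Fin.cases ?_ (fun j => ?_) i <;> rfl

theorem skipTuple_cons {a b n : ℕ} (h : a + b = n) (z : Phase d) (w : Fin n → Phase d) :
    skipTuple a b h (Fin.cons z w) = Fin.cons z fun i : Fin b => w ⟨a + i, by omega⟩ := by
  funext i
  refine Fin.cases rfl (fun j => ?_) i
  have e : (⟨a + 1 + j, by omega⟩ : Fin (n + 1)) = Fin.succ ⟨a + j, by omega⟩ :=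
    Fin.ext (by simp; omega)
  rw [skipTuple, Fin.cons_succ, Fin.cons_succ, e, Fin.cons_succ]

theorem contDiff_comp_const {φ : (Fin 1 → Phase d) → ℝ} (hφ : ContDiff ℝ ∞ φ) :
    ContDiff ℝ ∞ fun z : Phase d => φ fun _ => z :=
  hφ.comp (contDiff_pi.2 fun _ => contDiff_id)

/-- The particles `2, …, k` of a contraction split into two disjoint groups, over which the
iterated pairing factorizes. -/
theorem iteratedPairing_contract (γ : State d 1) {a b n : ℕ} (h : a + b = n) (f : Obs d (a + 1))
    (g : Obs d (b + 1)) :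
    iteratedPairing γ (n + 1) (contract a b h f g) = pairOne γ fun z =>
      ∑ m, dx (partialPairing (statePow γ a) f) 0 m (fun _ => z) *
        dv (partialPairing (statePow γ b) g) 0 m (fun _ => z) := by
  rw [iteratedPairing]
  congr 1
  funext z
  have hx : ∀ m, ContDiff ℝ ∞ fun w : Fin a → Phase d => dx f 0 m (Fin.cons z w) :=
    fun m => contDiff_comp_finCons (contDiff_dx f.contDiff 0 m) z
  have hv : ∀ m, ContDiff ℝ ∞ fun w : Fin b → Phase d => dv g 0 m (Fin.cons z w) :=
    fun m => contDiff_comp_finCons (contDiff_dv g.contDiff 0 m) z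
  simp only [contract, headTuple_cons, skipTuple_cons, dx_partialPairing, dv_partialPairing]
  have hc : ∀ {l : ℕ} (e : Fin l → Fin n),
      ContDiff ℝ ∞ fun (w : Fin n → Phase d) (i : Fin l) => w (e i) :=
    fun e => contDiff_pi.2 fun i => contDiff_apply ℝ (Phase d) (e i)
  refine (iteratedPairing_sum γ Finset.univ (f := fun m w =>
    dx f 0 m (Fin.cons z fun i : Fin a => w ⟨i, by omega⟩) *
      dv g 0 m (Fin.cons z fun i : Fin b => w ⟨a + i, by omega⟩))
    fun m => ((hx m).comp (hc fun i => ⟨i, by omega⟩)).mul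
      ((hv m).comp (hc fun i => ⟨a + i, by omega⟩))).trans ?_
  exact Finset.sum_congr rfl fun m _ => iteratedPairing_mul γ h (hx m) (hv m)

/-- For one particle the Lie bracket is the Poisson bracket; here its two terms are separated. -/
theorem apply_lieObs (γ : State d 1) (φ ψ : Obs d 1) :
    γ (lieObs φ ψ) = pairOne γ (fun z => ∑ m, dx φ 0 m (fun _ => z) * dv ψ 0 m (fun _ => z)) -
      pairOne γ (fun z => ∑ m, dx ψ 0 m (fun _ => z) * dv φ 0 m (fun _ => z)) := by
  have hs : ∀ φ ψ : Obs d 1,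
      ContDiff ℝ ∞ fun z : Phase d => ∑ m, dx φ 0 m (fun _ => z) * dv ψ 0 m (fun _ => z) :=
    fun φ ψ => ContDiff.sum fun m _ => (contDiff_comp_const (contDiff_dx φ.contDiff 0 m)).mul
      (contDiff_comp_const (contDiff_dv ψ.contDiff 0 m))
  rw [← pairOne_eq_apply, sub_eq_add_neg, ← neg_one_mul, ← pairOne_const_mul γ (hs ψ φ),
    ← pairOne_add γ (hs φ ψ) (contDiff_const.mul (hs ψ φ))]
  congr 1
  funext z
  change ((1 : ℕ) : ℝ) * poisson φ ψ (fun _ => z) = _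
  rw [poisson, Fin.sum_univ_one, Finset.sum_sub_distrib, Nat.cast_one, one_mul, neg_one_mul,
    ← sub_eq_add_neg]
  simp only [mul_comm (dv φ 0 _ _)]

/-- On a factorized state, `Sym (f ∧₁ g)` has the value of the one-particle bracket of the partial
pairings of `f` and `g`. -/
theorem statePow_sym_wedge (γ : State d 1) (a b : ℕ) (f : Obs d (a + 1)) (g : Obs d (b + 1)) :
    statePow γ (a + b + 1) (sym (wedge a b f g) (contDiff_wedge a b f g)) =
      ((a + 1 : ℕ) : ℝ) * ((b + 1 : ℕ) : ℝ) *
        γ (lieObs (partialPairing (statePow γ a) f) (partialPairing (statePow γ b) g)) := by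
  rw [statePow_sym, apply_lieObs, ← iteratedPairing_contract γ rfl f g,
    ← iteratedPairing_contract γ (Nat.add_comm b a) g f]
  have h1 := contDiff_contract a b rfl f g
  have h2 := contDiff_contract b a (Nat.add_comm b a) g f
  rw [sub_eq_add_neg, ← neg_one_mul, ← iteratedPairing_const_mul γ h2,
    ← iteratedPairing_add γ h1 (contDiff_const.mul h2),
    ← iteratedPairing_const_mul γ (h1.add (contDiff_const.mul h2))]
  congr 1
  funext z
  rw [wedge, sub_eq_add_neg, ← neg_one_mul]

theorem dx_add (φ ψ : Obs d k) (i : Fin k) (m : Fin d) (z : Fin k → Phase d) :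
    dx (φ + ψ : Obs d k) i m z = dx φ i m z + dx ψ i m z := by
  rw [dx, Obs.coe_add, fderiv_add ((φ.contDiff.differentiable (by simp)) z)
    ((ψ.contDiff.differentiable (by simp)) z)]
  rfl

theorem dv_add (φ ψ : Obs d k) (i : Fin k) (m : Fin d) (z : Fin k → Phase d) :
    dv (φ + ψ : Obs d k) i m z = dv φ i m z + dv ψ i m z := by
  rw [dv, Obs.coe_add, fderiv_add ((φ.contDiff.differentiable (by simp)) z)
    ((ψ.contDiff.differentiable (by simp)) z)]
  rfl

theorem dx_smul (c : ℝ) (φ : Obs d k) (i : Fin k) (m : Fin d) (z : Fin k → Phase d) :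
    dx (c • φ : Obs d k) i m z = c * dx φ i m z := by
  rw [dx, Obs.coe_smul, fderiv_const_smul ((φ.contDiff.differentiable (by simp)) z)]
  rfl

theorem dv_smul (c : ℝ) (φ : Obs d k) (i : Fin k) (m : Fin d) (z : Fin k → Phase d) :
    dv (c • φ : Obs d k) i m z = c * dv φ i m z := by
  rw [dv, Obs.coe_smul, fderiv_const_smul ((φ.contDiff.differentiable (by simp)) z)]
  rfl

theorem lieObs_apply (φ ψ : Obs d k) (z : Fin k → Phase d) :
    lieObs φ ψ z = k * ∑ i, ∑ m, (dx φ i m z * dv ψ i m z - dv φ i m z * dx ψ i m z) := rfl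

/-- Antisymmetry of the bracket, which reduces linearity on the right to linearity on the left. -/
theorem lieObs_swap (φ ψ : Obs d k) : lieObs φ ψ = (-1 : ℝ) • lieObs ψ φ :=
  Obs.ext fun z => by
    rw [Obs.coe_smul, Pi.smul_apply, lieObs_apply, lieObs_apply, smul_eq_mul, neg_one_mul,
      ← mul_neg, ← Finset.sum_neg_distrib]
    simp only [← Finset.sum_neg_distrib]
    congr 1
    refine Finset.sum_congr rfl fun i _ => Finset.sum_congr rfl fun m _ => ?_
    ring

theorem lieObs_add_left (φ φ' ψ : Obs d k) :
    lieObs (φ + φ') ψ = lieObs φ ψ + lieObs φ' ψ :=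
  Obs.ext fun z => by
    rw [Obs.coe_add, Pi.add_apply, lieObs_apply, lieObs_apply, lieObs_apply, ← mul_add,
      ← Finset.sum_add_distrib]
    simp only [← Finset.sum_add_distrib, dx_add, dv_add]
    congr 1
    refine Finset.sum_congr rfl fun i _ => Finset.sum_congr rfl fun m _ => ?_
    ring

theorem lieObs_smul_left (c : ℝ) (φ ψ : Obs d k) : lieObs (c • φ) ψ = c • lieObs φ ψ :=
  Obs.ext fun z => by
    rw [Obs.coe_smul, Pi.smul_apply, lieObs_apply, lieObs_apply, smul_eq_mul, mul_left_comm,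
      Finset.mul_sum]
    simp only [Finset.mul_sum, dx_smul, dv_smul]
    refine Finset.sum_congr rfl fun i _ => Finset.sum_congr rfl fun m _ => ?_
    ring

/-- The Lie bracket of `𝔤_k` as a bilinear map. -/
noncomputable def lieObsBilin (d k : ℕ) : Obs d k →ₗ[ℝ] Obs d k →ₗ[ℝ] Obs d k :=
  LinearMap.mk₂ ℝ lieObs lieObs_add_left lieObs_smul_left
    (fun φ ψ ψ' => by
      rw [lieObs_swap, lieObs_add_left, smul_add, ← lieObs_swap, ← lieObs_swap])
    (fun c φ ψ => by
      rw [lieObs_swap, lieObs_smul_left, smul_comm, ← lieObs_swap])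

open Classical in
theorem pullbackGradient_eq_sum (γ : State d 1) (F : ObsHierarchy d) :
    pullbackGradient γ F = ∑ a ∈ DFinsupp.support F,
      ((a + 1 : ℕ) : ℝ) • partialPairing (statePow γ a) (F a) := by
  conv_lhs => rw [← DirectSum.sum_support_of F, map_sum]
  exact Finset.sum_congr rfl fun a _ => pullbackGradient_of γ a (F a)

/-- The transposed derivative of the factorization map intertwines the two Lie brackets when paired
with a factorized state. -/
theorem apply_lieObs_pullbackGradient (γ : State d 1) (F G : ObsHierarchy d) :
    γ (lieObs (pullbackGradient γ F) (pullbackGradient γ G)) =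
      pairing (lieHierarchy F G) (factorization d γ) := by
  classical
  change γ (lieObsBilin d 1 (pullbackGradient γ F) (pullbackGradient γ G)) = _
  rw [pullbackGradient_eq_sum, pullbackGradient_eq_sum, lieHierarchy]
  change _ = DirectSum.toModule ℝ ℕ ℝ (fun n => (factorization d γ n : Obs d (n + 1) →ₗ[ℝ] ℝ)) _
  simp only [map_sum, LinearMap.sum_apply]
  rw [Finset.sum_comm]
  refine Finset.sum_congr rfl fun a _ => Finset.sum_congr rfl fun b _ => ?_
  refine Eq.trans ?_ (pairing_of (a + b) _ (factorization d γ)).symm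
  rw [factorization_apply, statePow_sym_wedge]
  simp only [map_smul, LinearMap.smul_apply, smul_eq_mul]
  rw [← mul_assoc, mul_comm ((b + 1 : ℕ) : ℝ)]
  rfl

end Bracket

end Vlasov

theorem mainTheorem1 (d : ℕ) :
    -- every component of `ι(γ)` is the tensor power of the distribution `γ`
    (∀ (γ : Vlasov.State d 1) (n : ℕ) (f : Vlasov.Obs d (n + 1)),
      Vlasov.factorization d γ n f = Vlasov.iteratedPairing γ (n + 1) f) ∧
    -- `ι` is of class `C^∞`
    Vlasov.GateauxSmooth (Vlasov.factorization d) ∧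
    -- admissible functionals and their pullbacks are smooth, and their derivatives are
    -- represented by unique elements of `𝔊_∞` and of `𝔤_1`
    (∀ 𝓕 ∈ Vlasov.admissible d,
      Vlasov.GateauxSmooth 𝓕 ∧
      Vlasov.GateauxSmooth (𝓕 ∘ Vlasov.factorization d) ∧
      (∀ Γ, ∃! F, Vlasov.IsHierarchyGradient 𝓕 Γ F) ∧
      (∀ γ, ∃! f, Vlasov.IsGradient (𝓕 ∘ Vlasov.factorization d) γ f)) ∧
    -- `ι` preserves the brackets
    (∀ 𝓕 ∈ Vlasov.admissible d, ∀ 𝓖 ∈ Vlasov.admissible d,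
      Vlasov.liePoisson (𝓕 ∘ Vlasov.factorization d) (𝓖 ∘ Vlasov.factorization d) =
        Vlasov.liePoissonHierarchy 𝓕 𝓖 ∘ Vlasov.factorization d) ∧
    -- `ι` pulls back the Vlasov hierarchy Hamiltonian to the Vlasov Hamiltonian
    (∀ (W : EuclideanSpace ℝ (Fin d) → ℝ) (hW : ContDiff ℝ ∞ W) (hev : ∀ x, W (-x) = W x),
      Vlasov.vlasovHierarchyHamiltonian W hW hev ∘ Vlasov.factorization d =
        Vlasov.vlasovHamiltonian W hW hev) := by
  refine ⟨fun γ n f => ?_, Vlasov.gateauxSmooth_factorization d, fun 𝓕 h𝓕 =>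
    ⟨?_, ?_, fun Γ => ?_, fun γ => ?_⟩, fun 𝓕 h𝓕 𝓖 h𝓖 => funext fun γ => ?_,
    fun W hW hev => funext fun γ => ?_⟩
  · rw [Vlasov.factorization_apply, Vlasov.statePow_apply]
  · exact Vlasov.gateauxSmooth_of_forall_gateauxContDiff fun n =>
      Vlasov.gateauxContDiff_admissible h𝓕 n
  · exact Vlasov.gateauxSmooth_of_forall_gateauxContDiff fun n =>
      Vlasov.gateauxContDiff_admissible_factorization h𝓕 n
  · obtain ⟨F, hF, -⟩ := Vlasov.exists_isHierarchyGradient h𝓕 Γ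
    exact ⟨F, hF, fun G hG => hG.unique hF⟩
  · obtain ⟨F, -, hF⟩ := Vlasov.exists_isHierarchyGradient h𝓕 (Vlasov.factorization d γ)
    exact ⟨_, hF γ rfl, fun g hg => hg.unique (hF γ rfl)⟩
  · obtain ⟨F, hF, hF'⟩ := Vlasov.exists_isHierarchyGradient h𝓕 (Vlasov.factorization d γ)
    obtain ⟨G, hG, hG'⟩ := Vlasov.exists_isHierarchyGradient h𝓖 (Vlasov.factorization d γ)
    rw [Vlasov.liePoisson, (hF' γ rfl).gradient_eq, (hG' γ rfl).gradient_eq, Function.comp_apply,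
      Vlasov.liePoissonHierarchy, hF.hierarchyGradient_eq, hG.hierarchyGradient_eq,
      Vlasov.apply_lieObs_pullbackGradient]
  · rw [Function.comp_apply, Vlasov.vlasovHierarchyHamiltonian, Vlasov.pairing_add,
      Vlasov.pairing_of, Vlasov.pairing_of, Vlasov.vlasovHamiltonian]
    congr 1
    rw [Vlasov.factorization_apply, Vlasov.statePow_apply, ← Vlasov.pairOne_eq_apply]
    rfl
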